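/- Let $\mathbf D$ be the set of cadlag functions $\omega:\mathbb R_+\to\mathbb R$, let $X_t(\omega)=\omega(t)$ be the coordinate process, and put $\mathcal F=\sigma(X_t:t\in\mathbb R_+)$ and $\mathcal F_t=\sigma(X_s:0\le s\le t)$. We use the following notions for a real-valued process. - $X$ is *strong Markov* if for every bounded measurable $g:\mathbb R\to\mathbb R$ and every $t\in\mathbb R_+$ there is a measurable $f:\mathbb R_+\times\mathbb R\to\mathbb R$ such that $f(\tau,X_\tau)=\mathbb E[g(X_{\tau+t})\mid\mathcal F_\tau]$ almost surely for every finite $(\mathcal F_t)$-stopping time $\tau$. - $X$ is *almost-continuous* if it is cadlag, is continuous in probability, and, for any two independent cadlag processes $Y,Z$, each with the same distribution as $X$, and all $s<t$ in $\mathbb R_+$, $$\mathbb P\bigl(Y_s<Z_s,\ Y_t>Z_t\text{ and }Y_u\neq Z_u\text{ for every }u\in(s,t)\bigr)=0.$$ - $X$ is an *almost-continuous diffusion* if it is strong Markov and almost-continuous. **Lemma.** Let $\mathbb P$ be a probability measure on $(\mathbf D,\mathcal F)$ under which $X$ is continuous in probability. Then each of the following statements implies the next. 1. $X$ is an almost-continuous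 diffusion. 2. For all $s<t$ in $\mathbb R_+$, all non-negative $\mathcal F_s$-measurable random variables $U,V$, and all real numbers $a$ and $b<c\le d<e$, $$\mathbb E\bigl[U1_{\{X_s<a,\ d<X_t<e\}}\bigr]\,\mathbb E\bigl[V1_{\{X_s>a,\ b<X_t<c\}}\bigr]\le\mathbb E\bigl[U1_{\{X_s<a,\ b<X_t<c\}}\bigr]\,\mathbb E\bigl[V1_{\{X_s>a,\ d<X_t<e\}}\bigr],$$ where the expectations take values in $[0,\infty]$ and $0\cdot\infty=0$. 3. $X$ is almost-continuous. -/

import Mathlib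

open MeasureTheory ProbabilityTheory Filter Topology
open scoped NNReal ENNReal

/-- A function on `[0, ∞)` is cadlag if it is right-continuous with left limits. (At `t = 0` the
condition on the left limit is empty.) -/
def IsCadlag (f : ℝ≥0 → ℝ) : Prop :=
  (∀ t, ContinuousWithinAt f (Set.Ici t) t) ∧ ∀ t, ∃ l, Tendsto f (𝓝[<] t) (𝓝 l)

/-- The space `D` of cadlag functions `[0, ∞) → ℝ`. -/
def CadlagPath : Type := {ω : ℝ≥0 → ℝ // IsCadlag ω}

/-- The coordinate process `X` on `D`. -/
def coordProcess (t : ℝ≥0) (ω : CadlagPath) : ℝ := ω.1 t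

/-- The σ-algebra on `D` generated by all the coordinates. -/
instance CadlagPath.instMeasurableSpace : MeasurableSpace CadlagPath :=
  ⨆ t : ℝ≥0, (inferInstance : MeasurableSpace ℝ).comap (coordProcess t)

theorem measurable_coordProcess (t : ℝ≥0) : Measurable (coordProcess t) :=
  Measurable.of_comap_le
    (le_iSup (fun t : ℝ≥0 => (inferInstance : MeasurableSpace ℝ).comap (coordProcess t)) t)

/-- The filtration on `D` given by `F_t = σ(X_s : s ≤ t)`. -/
noncomputable def coordFiltration : Filtration ℝ≥0 CadlagPath.instMeasurableSpace :=
  Filtration.natural coordProcess fun t => (measurable_coordProcess t).stronglyMeasurable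

/-- `X` is continuous in probability under `P`. -/
def ContinuousInProbability {Ω : Type*} [MeasurableSpace Ω] (X : ℝ≥0 → Ω → ℝ) (P : Measure Ω) :
    Prop :=
  ∀ t, TendstoInMeasure P X (𝓝 t) (X t)

/-- The strong Markov property of a (cadlag, adapted) process `X`: for every bounded measurable `g`
and every `t` there is a single measurable `f` such that `f (τ, X_τ) = E[g (X_{τ + t}) | F_τ]`
almost surely, for every finite stopping time `τ`. -/
def IsStrongMarkov {Ω : Type*} {mΩ : MeasurableSpace Ω} (X : ℝ≥0 → Ω → ℝ)
    (𝓕 : Filtration ℝ≥0 mΩ) (P : Measure Ω) : Prop :=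
  ∀ g : ℝ → ℝ, Measurable g → (∃ C : ℝ, ∀ x, |g x| ≤ C) → ∀ t : ℝ≥0,
    ∃ f : ℝ≥0 × ℝ → ℝ, Measurable f ∧
      ∀ (τ : Ω → ℝ≥0) (hτ : IsStoppingTime 𝓕 (fun ω => (τ ω : WithTop ℝ≥0))),
        (fun ω => f (τ ω, X (τ ω) ω)) =ᵐ[P]
          P[fun ω => g (X (τ ω + t) ω) | hτ.measurableSpace]

/-- `X` is almost-continuous under `P`: it is cadlag, continuous in probability, and two independent
cadlag copies `Y`, `Z` of `X`, on any probability space, almost surely do not change order between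
two given times without meeting in between. The probability in the last condition is the outer
measure, as the event need not be in the σ-algebra; the condition only depends on the law of `X`,
so that it is no restriction to take the probability spaces in `Type`. -/
structure IsAlmostContinuous {Ω : Type*} [MeasurableSpace Ω] (X : ℝ≥0 → Ω → ℝ) (P : Measure Ω) :
    Prop where
  cadlag : ∀ ω, IsCadlag fun t => X t ω
  continuousInProbability : ContinuousInProbability X P
  crossing : ∀ (Ω' : Type) [MeasurableSpace Ω'] (P' : Measure Ω') [IsProbabilityMeasure P']
    (Y Z : ℝ≥0 → Ω' → ℝ),
    (∀ t, Measurable (Y t)) → (∀ t, Measurable (Z t)) →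
    (∀ ω, IsCadlag fun t => Y t ω) → (∀ ω, IsCadlag fun t => Z t ω) →
    IndepFun (fun ω t => Y t ω) (fun ω t => Z t ω) P' →
    IdentDistrib (fun ω t => Y t ω) (fun ω t => X t ω) P' P →
    IdentDistrib (fun ω t => Z t ω) (fun ω t => X t ω) P' P →
    ∀ s t : ℝ≥0, s < t →
      P' {ω | Y s ω < Z s ω ∧ Z t ω < Y t ω ∧ ∀ u ∈ Set.Ioo s t, Y u ω ≠ Z u ω} = 0

/-- An almost-continuous diffusion: a strong Markov and almost-continuous process. -/
def IsAlmostContinuousDiffusion {Ω : Type*} {mΩ : MeasurableSpace Ω} (X : ℝ≥0 → Ω → ℝ)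
    (𝓕 : Filtration ℝ≥0 mΩ) (P : Measure Ω) : Prop :=
  IsStrongMarkov X 𝓕 P ∧ IsAlmostContinuous X P

/-- The product inequality
`E[U; X_s < a, d < X_t < e] E[V; X_s > a, b < X_t < c]`
`≤ E[U; X_s < a, b < X_t < c] E[V; X_s > a, d < X_t < e]`
for all `s < t`, all nonnegative `F_s`-measurable random variables `U`, `V`, and all real numbers
`a` and `b < c ≤ d < e`. The expectations are taken in `[0, ∞]`, with `0 * ∞ = 0`. -/
def ProductInequality {Ω : Type*} {mΩ : MeasurableSpace Ω} (X : ℝ≥0 → Ω → ℝ)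
    (𝓕 : Filtration ℝ≥0 mΩ) (P : Measure Ω) : Prop :=
  ∀ s t : ℝ≥0, s < t → ∀ U V : Ω → ℝ≥0, Measurable[𝓕 s] U → Measurable[𝓕 s] V →
    ∀ a b c d e : ℝ, b < c → c ≤ d → d < e →
      (∫⁻ ω in {ω | X s ω < a ∧ d < X t ω ∧ X t ω < e}, (U ω : ℝ≥0∞) ∂P) *
          (∫⁻ ω in {ω | a < X s ω ∧ b < X t ω ∧ X t ω < c}, (V ω : ℝ≥0∞) ∂P) ≤
        (∫⁻ ω in {ω | X s ω < a ∧ b < X t ω ∧ X t ω < c}, (U ω : ℝ≥0∞) ∂P) *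
          (∫⁻ ω in {ω | a < X s ω ∧ d < X t ω ∧ X t ω < e}, (V ω : ℝ≥0∞) ∂P)

/-!
Call the coordinate process *leap-free* under `P` (`NoLeap`) if, of two independent copies `y`, `z`
with `y < z` just before a time `v`, almost surely `y v ≤ z v`. By right-continuity this is the same
as almost-continuity (`IsAlmostContinuous.noLeap`, `NoLeap.isAlmostContinuous`): the first time at
which the order of the paths is lost is either a meeting or a leap. Both implications go through
this property, and both use the first time `touchTime` at which the paths or their left limits meet
or change order. Unlike the first meeting time it is a stopping time of the raw filtration in each
of the two paths. Independent copies that touch do meet (`ae_le_touchTime`): otherwise one of them,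
`y`, jumps away from the other one at the moment their left limits meet; but then two copies of `y`
would do so independently for the same `z`, at different times as there are no fixed times of
discontinuity, and the first of them would leap over the second.

*From a diffusion to the product inequality.* The left-hand side is an integral over pairs of copies
that change order between `s` and `t`. Being leap-free, they meet at their touching time `T`. By the
strong Markov property of each copy, with the other one fixed, their values at a later time are,
given the past of `T`, independent with laws that depend only on `T` and the common value at `T`, so
they can be exchanged, which gives the right-hand side. As the increment in the strong Markov
property is deterministic, the exchange is made at the times `T + k / (n + 1)` just after `t`
(`IsStrongMarkov.lintegral_meetWeight_roundTo`), for continuous functions of the values, and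
`n → ∞`; indicators of intervals are increasing limits of such functions.

*From the product inequality to almost-continuity.* The inequality says that, on events of the past
of `s`, the ratio of two measures on `{X_s < a}` does not exceed their ratio on `{X_s > a}`. A
constant separates the ratios, and the inequality extends to events of the past of both copies
together (`SetProductInequality.measure_prod_le`). Summed along finer and finer grids, it shows that
leaps of `y` over `z` are at most as likely as the same configurations with the values after the
leap exchanged (`SetProductInequality.ae_not_lowerLeap`). The latter are null: if the left limits at
the leap are different, both paths would jump there, but independent copies have no common jumps
(`ae_not_common_jump`); if they are equal, the upper path would jump away from the lower one as they
touch. Leaps in which the other path jumps are reduced to these by the reflection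
`(y, z) ↦ (-z, -y)`.
-/

/-! ### Cadlag paths -/

instance CadlagPath.instCoeFun : CoeFun CadlagPath fun _ => ℝ≥0 → ℝ := ⟨Subtype.val⟩

theorem CadlagPath.continuousWithinAt_Ici (y : CadlagPath) (t : ℝ≥0) :
    ContinuousWithinAt y (Set.Ici t) t := y.2.1 t

theorem CadlagPath.exists_leftLim (y : CadlagPath) (t : ℝ≥0) :
    ∃ l, Tendsto y (𝓝[<] t) (𝓝 l) := y.2.2 t

/-- The path frozen at (in the language of stochastic processes, stopped at) the time `u`: it is
constant from `u` on. -/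
def CadlagPath.freeze (u : ℝ≥0) (y : CadlagPath) : CadlagPath :=
  ⟨fun t => y (min t u), by
    refine ⟨fun t => ?_, fun t => ?_⟩
    · exact (y.continuousWithinAt_Ici (min t u)).comp (f := fun x => min x u)
        (continuous_id.min continuous_const).continuousWithinAt
        fun x (hx : t ≤ x) => min_le_min_right u hx
    · rcases le_or_gt t u with h | h
      · obtain ⟨l, hl⟩ := y.exists_leftLim t
        refine ⟨l, hl.congr' ?_⟩
        filter_upwards [self_mem_nhdsWithin] with s hs
        rw [min_eq_left (le_of_lt (lt_of_lt_of_le hs h))]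
      · refine ⟨y u, tendsto_const_nhds.congr' ?_⟩
        filter_upwards [mem_nhdsWithin_of_mem_nhds (Ioi_mem_nhds h)] with s hs
        rw [min_eq_right (le_of_lt hs)]⟩

theorem CadlagPath.freeze_apply (u : ℝ≥0) (y : CadlagPath) (t : ℝ≥0) :
    y.freeze u t = y (min t u) := rfl

theorem CadlagPath.freeze_apply_of_le {u t : ℝ≥0} (y : CadlagPath) (h : t ≤ u) :
    y.freeze u t = y t := by rw [freeze_apply, min_eq_left h]

theorem CadlagPath.freeze_freeze_of_le {v u : ℝ≥0} (h : v ≤ u) (y : CadlagPath) :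
    (y.freeze u).freeze v = y.freeze v := by
  apply Subtype.ext
  funext t
  change y (min (min t v) u) = y (min t v)
  rw [min_eq_left ((min_le_right t v).trans h)]

/-- The reflected path `-y`. -/
def CadlagPath.reflect (y : CadlagPath) : CadlagPath :=
  ⟨fun t => -y t, fun t => (y.continuousWithinAt_Ici t).neg, fun t =>
    let ⟨l, hl⟩ := y.exists_leftLim t
    ⟨-l, hl.neg⟩⟩

theorem CadlagPath.reflect_apply (y : CadlagPath) (t : ℝ≥0) : y.reflect t = -y t := rfl

theorem CadlagPath.reflect_reflect (y : CadlagPath) : y.reflect.reflect = y :=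
  Subtype.ext (funext fun t => neg_neg (y t))

/-! ### Measurability on the path space -/

theorem CadlagPath.measurable_apply (t : ℝ≥0) : Measurable fun y : CadlagPath => y t :=
  measurable_coordProcess t

theorem measurable_toCadlagPath {α : Type*} [MeasurableSpace α] {f : α → CadlagPath}
    (h : ∀ t, Measurable fun a => f a t) : Measurable f := by
  refine measurable_iff_comap_le.2 ?_
  rw [CadlagPath.instMeasurableSpace, MeasurableSpace.comap_iSup]
  refine iSup_le fun t => ?_
  rw [MeasurableSpace.comap_comp]
  exact (h t).comap_le

theorem CadlagPath.measurable_freeze (u : ℝ≥0) : Measurable (CadlagPath.freeze u) :=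
  measurable_toCadlagPath fun t => CadlagPath.measurable_apply (min t u)

theorem CadlagPath.measurable_reflect : Measurable CadlagPath.reflect :=
  measurable_toCadlagPath fun t => (CadlagPath.measurable_apply t).neg

/-- `F_u` consists of the events that depend only on the path frozen at `u`. -/
theorem coordFiltration_eq_comap_freeze (u : ℝ≥0) :
    coordFiltration u = CadlagPath.instMeasurableSpace.comap (CadlagPath.freeze u) := by
  change (⨆ j ≤ u, MeasurableSpace.comap (coordProcess j) _) = _
  apply le_antisymm
  · refine iSup₂_le fun j hj => ?_
    have : coordProcess j = coordProcess j ∘ CadlagPath.freeze u := by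
      funext y
      exact (y.freeze_apply_of_le hj).symm
    rw [this, ← MeasurableSpace.comap_comp]
    exact MeasurableSpace.comap_mono (measurable_coordProcess j).comap_le
  · rw [CadlagPath.instMeasurableSpace, MeasurableSpace.comap_iSup]
    refine iSup_le fun t => ?_
    rw [MeasurableSpace.comap_comp]
    exact le_iSup₂_of_le (min t u) (min_le_right t u) le_rfl

theorem measurableSet_coordFiltration_iff {u : ℝ≥0} {A : Set CadlagPath} :
    MeasurableSet[coordFiltration u] A ↔
      MeasurableSet A ∧ ∀ y, CadlagPath.freeze u y ∈ A ↔ y ∈ A := by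
  constructor
  · intro h
    refine ⟨coordFiltration.le u _ h, ?_⟩
    rw [coordFiltration_eq_comap_freeze] at h
    obtain ⟨B, -, rfl⟩ := h
    intro y
    simp only [Set.mem_preimage, CadlagPath.freeze_freeze_of_le le_rfl]
  · rintro ⟨h, h'⟩
    rw [coordFiltration_eq_comap_freeze]
    exact ⟨A, h, Set.ext h'⟩

/-- An `F_s`-measurable random variable depends only on the path frozen at any later time. -/
theorem apply_freeze_eq_of_measurable {α : Type*} [MeasurableSpace α] [MeasurableSingletonClass α]
    {s u : ℝ≥0} (hsu : s ≤ u) {U : CadlagPath → α} (hU : Measurable[coordFiltration s] U)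
    (y : CadlagPath) : U (y.freeze u) = U y :=
  (measurableSet_coordFiltration_iff.1 (coordFiltration.mono hsu _
    (hU (measurableSet_singleton (U y))))).2 y |>.2 rfl

/-- Joint measurability of the evaluation `(u, y) ↦ y u`, by right-continuity. -/
theorem measurable_eval : Measurable fun p : ℝ≥0 × CadlagPath => p.2 p.1 := by
  refine measurable_of_tendsto_metrizable
    (f := fun (n : ℕ) (p : ℝ≥0 × CadlagPath) => p.2 (⌈((n : ℝ≥0) + 1) * p.1⌉₊ / ((n : ℝ≥0) + 1)))
    (fun n => ?_) ?_
  · have h1 : Measurable fun q : CadlagPath × ℕ => q.1 ((q.2 : ℝ≥0) / ((n : ℝ≥0) + 1)) :=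
      measurable_from_prod_countable_left fun k =>
        CadlagPath.measurable_apply ((k : ℝ≥0) / ((n : ℝ≥0) + 1))
    have h2 : Measurable fun p : ℝ≥0 × CadlagPath => (p.2, ⌈((n : ℝ≥0) + 1) * p.1⌉₊) :=
      measurable_snd.prodMk (Nat.measurable_ceil.comp (measurable_fst.const_mul _))
    exact h1.comp h2
  · rw [tendsto_pi_nhds]
    rintro ⟨u, y⟩
    refine (y.continuousWithinAt_Ici u).tendsto.comp (tendsto_nhdsWithin_iff.2 ⟨?_, ?_⟩)
    · have h0 : Tendsto (fun n : ℕ => 1 / ((n : ℝ≥0) + 1)) atTop (𝓝 0) :=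
        tendsto_one_div_add_atTop_nhds_zero_nat
      have h1 : Tendsto (fun n : ℕ => u + 1 / ((n : ℝ≥0) + 1)) atTop (𝓝 u) := by
        simpa using h0.const_add u
      refine tendsto_of_tendsto_of_tendsto_of_le_of_le tendsto_const_nhds h1 (fun n => ?_)
        (fun n => ?_)
      · have : 0 < (n : ℝ≥0) + 1 := by positivity
        simp only
        rw [le_div_iff₀ this, mul_comm]
        exact Nat.le_ceil _
      · have : 0 < (n : ℝ≥0) + 1 := by positivity
        simp only
        rw [div_le_iff₀ this, add_mul u, one_div, inv_mul_cancel₀ this.ne', mul_comm u]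
        exact (Nat.ceil_lt_add_one (by positivity)).le
    · refine Eventually.of_forall fun n => ?_
      have : 0 < (n : ℝ≥0) + 1 := by positivity
      simp only [Set.mem_Ici]
      rw [le_div_iff₀ this, mul_comm]
      exact Nat.le_ceil _

theorem Measurable.eval_path {α : Type*} [MeasurableSpace α] {f : α → CadlagPath} {v : α → ℝ≥0}
    (hf : Measurable f) (hv : Measurable v) : Measurable fun a => f a (v a) :=
  measurable_eval.comp (hv.prodMk hf)

/-! ### Jumps -/

/-- `y` has a jump at `v`. It is phrased along the sequence `v - 1 / (n + 1)`, so that it is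
visibly a measurable condition on `(y, v)`; the truncated subtraction makes it false at `v = 0`. -/
def JumpsAt (y : CadlagPath) (v : ℝ≥0) : Prop :=
  ¬ Tendsto (fun n : ℕ => y (v - 1 / ((n : ℝ≥0) + 1))) atTop (𝓝 (y v))

theorem tendsto_sub_one_div_nhdsLT {v : ℝ≥0} (hv : 0 < v) :
    Tendsto (fun n : ℕ => v - 1 / ((n : ℝ≥0) + 1)) atTop (𝓝[<] v) := by
  refine tendsto_nhdsWithin_iff.2
    ⟨?_, Eventually.of_forall fun n => tsub_lt_self hv (by positivity)⟩
  have h0 : Tendsto (fun n : ℕ => 1 / ((n : ℝ≥0) + 1)) atTop (𝓝 0) :=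
    tendsto_one_div_add_atTop_nhds_zero_nat
  simpa using (tendsto_const_nhds (x := v)).sub h0

theorem jumpsAt_iff {y : CadlagPath} {v : ℝ≥0} (hv : 0 < v) {l : ℝ}
    (hl : Tendsto y (𝓝[<] v) (𝓝 l)) : JumpsAt y v ↔ l ≠ y v := by
  have h := hl.comp (tendsto_sub_one_div_nhdsLT hv)
  refine not_congr ⟨fun h' => tendsto_nhds_unique h h', ?_⟩
  rintro rfl
  exact h

theorem measurableSet_jumpsAt {α : Type*} [MeasurableSpace α] {f : α → CadlagPath} {v : α → ℝ≥0}
    (hf : Measurable f) (hv : Measurable v) : MeasurableSet {a | JumpsAt (f a) (v a)} := by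
  refine MeasurableSet.compl (measurableSet_tendsto_fun (fun n => ?_) (hf.eval_path hv))
  exact hf.eval_path (hv.sub_const _)

/-- A process that is continuous in probability has no fixed times of discontinuity. -/
theorem measure_jumpsAt_eq_zero {P : Measure CadlagPath}
    (hP : ContinuousInProbability coordProcess P) (v : ℝ≥0) : P {y | JumpsAt y v} = 0 := by
  rcases eq_or_ne v 0 with rfl | hv
  · convert measure_empty (μ := P)
    ext y
    simp [JumpsAt]
  have hv : 0 < v := pos_iff_ne_zero.2 hv
  have h1 : TendstoInMeasure P (fun n : ℕ => coordProcess (v - 1 / ((n : ℝ≥0) + 1))) atTop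
      (coordProcess v) := (hP v).comp
        ((tendsto_sub_one_div_nhdsLT hv).mono_right nhdsWithin_le_nhds)
  obtain ⟨ns, hns, h2⟩ := h1.exists_seq_tendsto_ae
  have h3 : ∀ᵐ y ∂P, ¬ JumpsAt y v := by
    filter_upwards [h2] with y hy
    obtain ⟨l, hl⟩ := y.exists_leftLim v
    rw [jumpsAt_iff hv hl, not_not]
    exact tendsto_nhds_unique
      ((hl.comp (tendsto_sub_one_div_nhdsLT hv)).comp hns.tendsto_atTop) hy
  simpa [ae_iff] using h3

/-- Two independent random times, the first without atoms on `A`, do not coincide on `A`. -/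
theorem prod_eq_zero_of_noAtoms {Ω Ω' : Type*} [MeasurableSpace Ω] [MeasurableSpace Ω']
    {P : Measure Ω} {Q : Measure Ω'} [IsFiniteMeasure P] [IsFiniteMeasure Q] {v : Ω → ℝ≥0}
    {w : Ω' → ℝ≥0} (hv : Measurable v) (hw : Measurable w) {A : Set Ω} (hA : MeasurableSet A)
    (h : ∀ c, P (A ∩ {y | v y = c}) = 0) :
    (P.prod Q) {p | p.1 ∈ A ∧ v p.1 = w p.2} = 0 := by
  have hm : MeasurableSet {p : Ω × Ω' | p.1 ∈ A ∧ v p.1 = w p.2} :=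
    (measurable_fst hA).inter
      (measurableSet_eq_fun (hv.comp measurable_fst) (hw.comp measurable_snd))
  rw [Measure.prod_apply_symm hm, lintegral_eq_zero_iff
    (measurable_measure_prodMk_right hm)]
  exact Eventually.of_forall fun z => h (w z)

/-! ### Separated paths and their first touching time -/

/-- On `[r, u]` the path `y` stays below `z` by at least a positive constant. Equivalently, neither
`y` and `z` nor their left limits meet or change order on that interval. -/
def Separated (r u : ℝ≥0) (y z : CadlagPath) : Prop :=
  ∃ ε > 0, ∀ p ∈ Set.Icc r u, y p + ε ≤ z p

section Separated

variable {r u v w L : ℝ≥0} {y z y' z' : CadlagPath}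

theorem Separated.mono (h : Separated r u y z) (hv : v ≤ u) : Separated r v y z :=
  let ⟨ε, hε, h⟩ := h
  ⟨ε, hε, fun p hp => h p ⟨hp.1, hp.2.trans hv⟩⟩

theorem Separated.lt (h : Separated r u y z) (hv : v ∈ Set.Icc r u) : y v < z v := by
  obtain ⟨ε, hε, h⟩ := h
  linarith [h v hv]

theorem separated_of_lt (h : u < r) : Separated r u y z :=
  ⟨1, one_pos, fun _ hp => absurd (hp.1.trans hp.2) (not_le.2 h)⟩

theorem separated_congr (hy : ∀ p ≤ u, y p = y' p) (hz : ∀ p ≤ u, z p = z' p) :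
    Separated r u y z ↔ Separated r u y' z' := by
  refine exists_congr fun ε => and_congr_right fun _ => forall₂_congr fun p hp => ?_
  rw [hy p hp.2, hz p hp.2]

theorem separated_reflect : Separated r u z.reflect y.reflect ↔ Separated r u y z := by
  refine exists_congr fun ε => and_congr_right fun _ => forall₂_congr fun p _ => ?_
  rw [CadlagPath.reflect_apply, CadlagPath.reflect_apply]
  constructor <;> intro h <;> linarith

theorem exists_Ico_lt_of_lt {a : ℝ} (h : y v + a < z v) :
    ∃ w > v, ∀ p ∈ Set.Ico v w, y p + a < z p := by
  have h1 : ∀ᶠ p in 𝓝[≥] v, y p + a < z p :=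
    ((y.continuousWithinAt_Ici v).add continuousWithinAt_const).eventually_lt
      (z.continuousWithinAt_Ici v) h
  obtain ⟨w, hw, h2⟩ := mem_nhdsGE_iff_exists_Ico_subset.1 h1
  exact ⟨w, hw, fun p hp => h2 hp⟩

theorem exists_Ioo_lt_of_lt {a l l' : ℝ} (hv : 0 < v) (hl : Tendsto y (𝓝[<] v) (𝓝 l))
    (hl' : Tendsto z (𝓝[<] v) (𝓝 l')) (h : l + a < l') :
    ∃ w < v, ∀ p ∈ Set.Ioo w v, y p + a < z p := by
  have h1 : ∀ᶠ p in 𝓝[<] v, y p + a < z p := (hl.add_const a).eventually_lt hl' h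
  obtain ⟨w, hw, h2⟩ := (mem_nhdsLT_iff_exists_Ioo_subset' hv).1 h1
  exact ⟨w, hw, fun p hp => h2 hp⟩

theorem Separated.exists_gt (h : Separated r v y z) (hr : r ≤ v) :
    ∃ w > v, Separated r w y z := by
  obtain ⟨ε, hε, h⟩ := h
  obtain ⟨w, hw, h2⟩ := exists_Ico_lt_of_lt (y := y) (z := z) (v := v) (a := ε / 2)
    (by linarith [h v ⟨hr, le_rfl⟩])
  obtain ⟨w', hw'⟩ := exists_between hw
  refine ⟨w', hw'.1, ε / 2, by positivity, fun p hp => ?_⟩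
  rcases le_or_gt v p with h3 | h3
  · exact (h2 p ⟨h3, hp.2.trans_lt hw'.2⟩).le
  · linarith [h p ⟨hp.1, h3.le⟩]

theorem separated_of_leftLim_lt {l l' : ℝ} (hv : 0 < v) (h : ∀ u < v, Separated r u y z)
    (hl : Tendsto y (𝓝[<] v) (𝓝 l)) (hl' : Tendsto z (𝓝[<] v) (𝓝 l')) (hll : l < l')
    (hyz : y v < z v) : Separated r v y z := by
  obtain ⟨w, hw, h1⟩ := exists_Ioo_lt_of_lt (a := (l' - l) / 2) hv hl hl' (by linarith)
  obtain ⟨w', hw'⟩ := exists_between hw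
  obtain ⟨ε, hε, h2⟩ := h w' hw'.2
  refine ⟨min (min ε ((l' - l) / 2)) (z v - y v),
    lt_min (lt_min hε (by linarith)) (by linarith), fun p hp => ?_⟩
  have a1 := min_le_left (min ε ((l' - l) / 2)) (z v - y v)
  have a2 := min_le_right (min ε ((l' - l) / 2)) (z v - y v)
  have a3 := min_le_left ε ((l' - l) / 2)
  have a4 := min_le_right ε ((l' - l) / 2)
  rcases le_or_gt p w' with h3 | h3
  · linarith [h2 p ⟨hp.1, h3⟩]
  rcases hp.2.lt_or_eq with h4 | rfl
  · linarith [h1 p ⟨hw'.1.trans h3, h4⟩]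
  · linarith

theorem exists_denseSeq_between {a b : ℝ≥0} (h : a < b) :
    ∃ k, a < TopologicalSpace.denseSeq ℝ≥0 k ∧ TopologicalSpace.denseSeq ℝ≥0 k < b := by
  obtain ⟨_, ⟨k, rfl⟩, hk⟩ :=
    (TopologicalSpace.denseRange_denseSeq ℝ≥0).exists_between h
  exact ⟨k, hk⟩

/-- By right-continuity, separation is decided by countably many times. -/
theorem separated_iff_denseSeq : Separated r u y z ↔
    ∃ n : ℕ, (r ≤ u → y u + 1 / ((n : ℝ) + 1) ≤ z u) ∧
      ∀ k, TopologicalSpace.denseSeq ℝ≥0 k ∈ Set.Icc r u →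
        y (TopologicalSpace.denseSeq ℝ≥0 k) + 1 / ((n : ℝ) + 1) ≤
          z (TopologicalSpace.denseSeq ℝ≥0 k) := by
  constructor
  · rintro ⟨ε, hε, h⟩
    obtain ⟨n, hn⟩ := exists_nat_one_div_lt hε
    exact ⟨n, fun hr => by linarith [h u ⟨hr, le_rfl⟩], fun k hk => by linarith [h _ hk]⟩
  · rintro ⟨n, h1, h2⟩
    refine ⟨1 / ((n : ℝ) + 1), by positivity, fun p hp => ?_⟩
    rcases hp.2.eq_or_lt with rfl | hpu
    · exact h1 hp.1
    by_contra! h3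
    obtain ⟨w, hw, h4⟩ := exists_Ico_lt_of_lt (y := z) (z := y) (v := p)
      (a := -(1 / ((n : ℝ) + 1))) (by linarith)
    obtain ⟨k, hk1, hk2⟩ := exists_denseSeq_between (lt_min hw hpu)
    have := h4 _ ⟨hk1.le, hk2.trans_le (min_le_left _ _)⟩
    linarith [h2 k ⟨hp.1.trans hk1.le, (hk2.trans_le (min_le_right _ _)).le⟩]

theorem measurableSet_separated (r u : ℝ≥0) :
    MeasurableSet {q : CadlagPath × CadlagPath | Separated r u q.1 q.2} := by
  have key : ∀ (v : ℝ≥0) (a : ℝ),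
      MeasurableSet {q : CadlagPath × CadlagPath | q.1 v + a ≤ q.2 v} := fun v a =>
    measurableSet_le (((CadlagPath.measurable_apply v).comp measurable_fst).add_const a)
      ((CadlagPath.measurable_apply v).comp measurable_snd)
  simp only [separated_iff_denseSeq, Set.ofPred_exists, Set.ofPred_and, Set.ofPred_forall]
  exact MeasurableSet.iUnion fun n => (MeasurableSet.iInter fun _ => key _ _).inter
    (MeasurableSet.iInter fun k => MeasurableSet.iInter fun _ => key _ _)

/-- The first time in `[r, L]` at which `y` and `z`, or their left limits, are no longer separated,
and `L` if there is none. Since left limits are taken into account, this is a stopping time for the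
raw filtration, which the first meeting time need not be. -/
noncomputable def touchTime (r L : ℝ≥0) (y z : CadlagPath) : ℝ≥0 :=
  sInf {v | r ≤ v ∧ (L ≤ v ∨ ¬ Separated r v y z)}

theorem le_touchTime (h : r ≤ L) : r ≤ touchTime r L y z :=
  le_csInf ⟨L, h, Or.inl le_rfl⟩ fun _ hv => hv.1

theorem touchTime_le (h : r ≤ L) : touchTime r L y z ≤ L :=
  csInf_le' ⟨h, Or.inl le_rfl⟩

theorem separated_of_lt_touchTime (h : v < touchTime r L y z) : Separated r v y z := by
  by_contra h1
  have hr : r ≤ v := by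
    by_contra! hr
    exact h1 (separated_of_lt hr)
  exact notMem_of_lt_csInf' h ⟨hr, Or.inr h1⟩

theorem touchTime_le_iff (h : r ≤ L) :
    touchTime r L y z ≤ u ↔ r ≤ u ∧ (L ≤ u ∨ ¬ Separated r u y z) := by
  refine ⟨fun hu => ⟨(le_touchTime h).trans hu, ?_⟩, fun hu => csInf_le' hu⟩
  by_contra! h1
  obtain ⟨w, hw, hs⟩ := h1.2.exists_gt ((le_touchTime h).trans hu)
  refine absurd hu (not_le.2 ((lt_min hw h1.1).trans_le
    (le_csInf ⟨L, h, Or.inl le_rfl⟩ fun v hv => ?_)))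
  rcases hv.2 with h2 | h2
  · exact (min_le_right _ _).trans h2
  · by_contra! h3
    exact h2 (hs.mono (h3.le.trans (min_le_left _ _)))

theorem not_separated_touchTime (h : r ≤ L) (hT : touchTime r L y z < L) :
    ¬ Separated r (touchTime r L y z) y z :=
  (((touchTime_le_iff h).1 le_rfl).2.resolve_left (not_le.2 hT))

theorem touchTime_eq (hr : r ≤ v) (hv : v < L) (h1 : ∀ u < v, Separated r u y z)
    (h2 : ¬ Separated r v y z) : touchTime r L y z = v := by
  refine le_antisymm ((touchTime_le_iff (hr.trans hv.le)).2 ⟨hr, Or.inr h2⟩) ?_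
  by_contra! h3
  exact not_separated_touchTime (hr.trans hv.le) (h3.trans hv) (h1 _ h3)

theorem lt_touchTime (h : r < L) (hr : y r < z r) : r < touchTime r L y z := by
  by_contra! h1
  refine (((touchTime_le_iff h.le).1 h1).2.resolve_left (not_le.2 h))
    ⟨z r - y r, by linarith, fun p hp => ?_⟩
  rw [le_antisymm hp.2 hp.1]
  linarith

theorem measurable_touchTime (h : r ≤ L) :
    Measurable fun q : CadlagPath × CadlagPath => touchTime r L q.1 q.2 := by
  refine measurable_of_Iic fun u => ?_
  simp only [Set.preimage, Set.mem_Iic, touchTime_le_iff h]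
  exact (MeasurableSet.const _).inter
    ((MeasurableSet.const _).union (measurableSet_separated r u).compl)

theorem touchTime_le_congr (h : r ≤ L) (hy : ∀ p ≤ u, y p = y' p) (hz : ∀ p ≤ u, z p = z' p) :
    touchTime r L y z ≤ u ↔ touchTime r L y' z' ≤ u := by
  rw [touchTime_le_iff h, touchTime_le_iff h, separated_congr hy hz]

theorem touchTime_reflect : touchTime r L z.reflect y.reflect = touchTime r L y z := by
  simp only [touchTime, separated_reflect]

/-- If the paths are still in order at their touching time, then only their left limits meet. -/
theorem leftLim_eq_of_touchTime (h : r < L) (hT : touchTime r L y z < L)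
    (hyz : y (touchTime r L y z) < z (touchTime r L y z)) :
    r < touchTime r L y z ∧ ∃ l, Tendsto y (𝓝[<] touchTime r L y z) (𝓝 l) ∧
      Tendsto z (𝓝[<] touchTime r L y z) (𝓝 l) := by
  have hr : r < touchTime r L y z := by
    refine (le_touchTime h.le).lt_of_ne fun h1 => ?_
    rw [← h1] at hyz
    exact (lt_touchTime h hyz).ne h1
  have h0 : 0 < touchTime r L y z := bot_le.trans_lt hr
  obtain ⟨l, hl⟩ := y.exists_leftLim (touchTime r L y z)
  obtain ⟨l', hl'⟩ := z.exists_leftLim (touchTime r L y z)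
  have hle : l ≤ l' := by
    have : (𝓝[<] touchTime r L y z).NeBot := nhdsLT_neBot_of_exists_lt ⟨0, h0⟩
    refine le_of_tendsto_of_tendsto hl hl' ?_
    filter_upwards [Ioo_mem_nhdsLT hr] with p hp
    exact ((separated_of_lt_touchTime hp.2).lt ⟨hp.1.le, le_rfl⟩).le
  refine ⟨hr, l, hl, ?_⟩
  rcases hle.lt_or_eq with h1 | rfl
  · exact absurd (separated_of_leftLim_lt h0 (fun u hu => separated_of_lt_touchTime hu) hl hl' h1
      hyz) (not_separated_touchTime h.le hT)
  · exact hl'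

end Separated

/-! ### Reflection of the law -/

/-- The map `(y, z) ↦ (-z, -y)`, which preserves the order of the two paths. -/
def reflectSwap : CadlagPath × CadlagPath ≃ᵐ CadlagPath × CadlagPath where
  toFun q := (q.2.reflect, q.1.reflect)
  invFun q := (q.2.reflect, q.1.reflect)
  left_inv q := by simp only [CadlagPath.reflect_reflect]
  right_inv q := by simp only [CadlagPath.reflect_reflect]
  measurable_toFun := (CadlagPath.measurable_reflect.comp measurable_snd).prodMk
    (CadlagPath.measurable_reflect.comp measurable_fst)
  measurable_invFun := (CadlagPath.measurable_reflect.comp measurable_snd).prodMk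
    (CadlagPath.measurable_reflect.comp measurable_fst)

instance isProbabilityMeasure_map_reflect (P : Measure CadlagPath) [IsProbabilityMeasure P] :
    IsProbabilityMeasure (P.map CadlagPath.reflect) :=
  Measure.isProbabilityMeasure_map CadlagPath.measurable_reflect.aemeasurable

theorem ae_prod_map_reflect_iff {P : Measure CadlagPath} [IsProbabilityMeasure P]
    {p : CadlagPath × CadlagPath → Prop} :
    (∀ᵐ q ∂(P.map CadlagPath.reflect).prod (P.map CadlagPath.reflect), p q) ↔
      ∀ᵐ q ∂P.prod P, p (q.2.reflect, q.1.reflect) := by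
  have h : (P.map CadlagPath.reflect).prod (P.map CadlagPath.reflect) =
      (P.prod P).map reflectSwap := by
    rw [Measure.map_prod_map _ _ CadlagPath.measurable_reflect CadlagPath.measurable_reflect]
    conv_lhs => rw [← Measure.prod_swap]
    rw [Measure.map_map (CadlagPath.measurable_reflect.prodMap CadlagPath.measurable_reflect)
      measurable_swap]
    rfl
  rw [h, reflectSwap.measurableEmbedding.ae_map_iff]
  rfl

theorem ae_prod_swap {Ω : Type*} [MeasurableSpace Ω] {P : Measure Ω} [SFinite P]
    {p : Ω × Ω → Prop} (h : ∀ᵐ q ∂P.prod P, p q) : ∀ᵐ q ∂P.prod P, p q.swap :=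
  Measure.measurePreserving_swap.quasiMeasurePreserving.ae h

theorem jumpsAt_reflect {y : CadlagPath} {v : ℝ≥0} : JumpsAt y.reflect v ↔ JumpsAt y v := by
  refine not_congr ⟨fun h => ?_, fun h => h.neg⟩
  have := h.neg
  simp only [CadlagPath.reflect_apply, neg_neg] at this
  exact this

/-- The coordinate process has no fixed time of discontinuity under `P`. -/
def NoFixedJump (P : Measure CadlagPath) : Prop :=
  ∀ v, P {y | JumpsAt y v} = 0

theorem NoFixedJump.map_reflect {P : Measure CadlagPath} (h : NoFixedJump P) :
    NoFixedJump (P.map CadlagPath.reflect) := by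
  intro v
  have hm : MeasurableSet {y | JumpsAt y v} := measurableSet_jumpsAt measurable_id measurable_const
  rw [Measure.map_apply CadlagPath.measurable_reflect hm]
  simpa only [Set.preimage, Set.mem_ofPred_eq, jumpsAt_reflect] using h v

/-! ### Independent copies have no common jumps -/

/-- The constant path. -/
def CadlagPath.const (c : ℝ) : CadlagPath :=
  ⟨fun _ => c, fun _ => continuousWithinAt_const, fun _ => ⟨c, tendsto_const_nhds⟩⟩

/-- A countable family of random times that exhausts all jump times of a path: the times at which
the path, or its reflection, reaches or jumps over a rational level after a time in a countable
dense set. -/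
noncomputable def levelTime (i : Bool × ℕ × ℕ × ℚ) (y : CadlagPath) : ℝ≥0 :=
  touchTime (TopologicalSpace.denseSeq ℝ≥0 i.2.1) (TopologicalSpace.denseSeq ℝ≥0 i.2.1 + i.2.2.1)
    (bif i.1 then y.reflect else y) (CadlagPath.const i.2.2.2)

theorem measurable_levelTime (i : Bool × ℕ × ℕ × ℚ) : Measurable (levelTime i) := by
  refine (measurable_touchTime le_self_add).comp (Measurable.prodMk ?_ measurable_const)
  cases i.1
  · exact measurable_id
  · exact CadlagPath.measurable_reflect

theorem exists_touchTime_const_eq {y : CadlagPath} {v : ℝ≥0} (hv : 0 < v) {l : ℝ}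
    (hl : Tendsto y (𝓝[<] v) (𝓝 l)) (h : l < y v) :
    ∃ (k m : ℕ) (c : ℚ), touchTime (TopologicalSpace.denseSeq ℝ≥0 k)
      (TopologicalSpace.denseSeq ℝ≥0 k + m) y (CadlagPath.const c) = v := by
  obtain ⟨c, hc1, hc2⟩ := exists_rat_btwn h
  obtain ⟨w, hw, h1⟩ := exists_Ioo_lt_of_lt (y := y) (z := CadlagPath.const c) (a := (c - l) / 2)
    (l' := c) hv hl tendsto_const_nhds (by linarith)
  obtain ⟨k, hk1, hk2⟩ := exists_denseSeq_between hw
  obtain ⟨m, hm⟩ := exists_nat_gt v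
  refine ⟨k, m, c, touchTime_eq hk2.le (hm.trans_le le_add_self) (fun u hu => ?_) fun hs => ?_⟩
  · exact ⟨(c - l) / 2, by linarith, fun p hp =>
      (h1 p ⟨hk1.trans_le hp.1, hp.2.trans_lt hu⟩).le⟩
  · exact absurd (hs.lt ⟨hk2.le, le_rfl⟩) (not_lt.2 hc2.le)

theorem exists_levelTime_eq {y : CadlagPath} {v : ℝ≥0} (h : JumpsAt y v) :
    ∃ i, levelTime i y = v := by
  have hv : 0 < v := by
    refine pos_iff_ne_zero.2 ?_
    rintro rfl
    exact h (by simp)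
  obtain ⟨l, hl⟩ := y.exists_leftLim v
  rw [jumpsAt_iff hv hl] at h
  rcases h.lt_or_gt with h | h
  · obtain ⟨k, m, c, hi⟩ := exists_touchTime_const_eq hv hl h
    exact ⟨(false, k, m, c), hi⟩
  · obtain ⟨k, m, c, hi⟩ := exists_touchTime_const_eq (y := y.reflect) hv hl.neg (neg_lt_neg h)
    exact ⟨(true, k, m, c), hi⟩

theorem ae_not_common_jump {P : Measure CadlagPath} [IsProbabilityMeasure P]
    (hJ : NoFixedJump P) :
    ∀ᵐ q ∂P.prod P, ∀ v, ¬ (JumpsAt q.1 v ∧ JumpsAt q.2 v) := by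
  have h : ∀ i j, ∀ᵐ q ∂P.prod P,
      ¬ (q.1 ∈ {y | JumpsAt y (levelTime i y)} ∧ levelTime i q.1 = levelTime j q.2) := by
    intro i j
    rw [ae_iff]
    simp only [not_not]
    refine prod_eq_zero_of_noAtoms (measurable_levelTime i) (measurable_levelTime j)
      (measurableSet_jumpsAt measurable_id (measurable_levelTime i)) fun c =>
        measure_mono_null ?_ (hJ c)
    rintro y ⟨h1, rfl⟩
    exact h1
  filter_upwards [ae_all_iff.2 fun i => ae_all_iff.2 (h i)] with q hq v hv
  obtain ⟨i, hi⟩ := exists_levelTime_eq hv.1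
  obtain ⟨j, hj⟩ := exists_levelTime_eq hv.2
  exact hq i j ⟨hi ▸ hv.1, hi.trans hj.symm⟩

/-! ### Leaps of one copy over another -/

/-- Of two independent copies, neither jumps over the other: if `y < z` on some `[w, v)`, then
`y v ≤ z v`. -/
def NoLeap (P : Measure CadlagPath) : Prop :=
  ∀ᵐ q ∂P.prod P, ∀ w v, w < v → (∀ u ∈ Set.Ico w v, q.1 u < q.2 u) → q.1 v ≤ q.2 v

/-- The weak form of `NoLeap` in which the left limits at the time of the jump are different. -/
def NoStrictLeap (P : Measure CadlagPath) : Prop :=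
  ∀ᵐ q ∂P.prod P, ∀ v, 0 < v → ∀ l l', Tendsto q.1 (𝓝[<] v) (𝓝 l) →
    Tendsto q.2 (𝓝[<] v) (𝓝 l') → l < l' → q.1 v ≤ q.2 v

theorem NoLeap.noStrictLeap {P : Measure CadlagPath} (h : NoLeap P) : NoStrictLeap P := by
  filter_upwards [h] with q hq v hv l l' hl hl' hll
  obtain ⟨w, hw, h1⟩ := exists_Ioo_lt_of_lt (a := 0) hv hl hl' (by linarith)
  obtain ⟨w', hw'⟩ := exists_between hw
  exact hq w' v hw'.2 fun u hu => by simpa using h1 u ⟨hw'.1.trans_le hu.1, hu.2⟩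

theorem NoStrictLeap.map_reflect {P : Measure CadlagPath} [IsProbabilityMeasure P]
    (h : NoStrictLeap P) : NoStrictLeap (P.map CadlagPath.reflect) := by
  refine ae_prod_map_reflect_iff.2 ?_
  filter_upwards [h] with q hq v hv l l' hl hl' hll
  have h1 := hl.neg
  have h2 := hl'.neg
  simp only [CadlagPath.reflect_apply, neg_neg] at h1 h2
  exact neg_le_neg (hq v hv _ _ h2 h1 (neg_lt_neg hll))

/-! ### Copies that touch do meet -/

/-- A copy does not jump away from a fixed path `z` at the first time their left limits meet. Two
independent copies `y`, `y'` would do so at different times `v < v'`; but at time `v` the copy `y'`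
would lie strictly below `y` just before `v`, and above it at `v`, where `y` has fallen below `z`
by an amount that `y'` has not yet reached. -/
theorem measure_jump_touchTime_eq_zero {P : Measure CadlagPath} [IsProbabilityMeasure P]
    (hJ : NoFixedJump P) (hL : NoStrictLeap P) {r L : ℝ≥0} (hrL : r < L) (z : CadlagPath) :
    P {y | touchTime r L y z < L ∧ y (touchTime r L y z) < z (touchTime r L y z) ∧
      JumpsAt y (touchTime r L y z)} = 0 := by
  have hT : Measurable fun y => touchTime r L y z :=
    (measurable_touchTime hrL.le).comp (measurable_id.prodMk measurable_const)
  set J : Set CadlagPath := {y | JumpsAt y (touchTime r L y z)} with hJdef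
  have hJm : MeasurableSet J := measurableSet_jumpsAt measurable_id hT
  have hties : ∀ᵐ q ∂P.prod P, ¬ (q.1 ∈ J ∧ touchTime r L q.1 z = touchTime r L q.2 z) := by
    rw [ae_iff]
    simp only [not_not]
    refine prod_eq_zero_of_noAtoms (w := fun y => touchTime r L y z) hT hT hJm fun c =>
        measure_mono_null ?_ (hJ c)
    rintro y ⟨h1, rfl⟩
    exact h1
  -- the paths that are more than `1 / (n + 1)` below `z` at the touching time, but less than that
  -- between the time `d k` and the touching time
  set A : ℕ → ℕ → Set CadlagPath := fun n k => {y | y ∈ J ∧ touchTime r L y z < L ∧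
    y (touchTime r L y z) + 1 / ((n : ℝ) + 1) < z (touchTime r L y z) ∧
    TopologicalSpace.denseSeq ℝ≥0 k < touchTime r L y z ∧
    ∀ u ∈ Set.Ico (TopologicalSpace.denseSeq ℝ≥0 k) (touchTime r L y z),
      z u < y u + 1 / ((n : ℝ) + 1)} with hA
  have hlt : ∀ n k, ∀ y ∈ A n k, ∀ y' ∈ A n k, touchTime r L y z < touchTime r L y' z →
      ¬ (∀ v, 0 < v → ∀ l l', Tendsto y' (𝓝[<] v) (𝓝 l) →
        Tendsto y (𝓝[<] v) (𝓝 l') → l < l' → y' v ≤ y v) := by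
    intro n k y hy y' hy' hvv h
    obtain ⟨hr, l, hl, hlz⟩ := leftLim_eq_of_touchTime hrL hy.2.1
      (by linarith [hy.2.2.1, show (0 : ℝ) < 1 / ((n : ℝ) + 1) by positivity])
    obtain ⟨l', hl'⟩ := y'.exists_leftLim (touchTime r L y z)
    have h0 : 0 < touchTime r L y z := bot_le.trans_lt hr
    have : (𝓝[<] touchTime r L y z).NeBot := nhdsLT_neBot_of_exists_lt ⟨0, h0⟩
    obtain ⟨ε, hε, hs⟩ := separated_of_lt_touchTime hvv
    have hll : l' + ε ≤ l := by
      refine le_of_tendsto_of_tendsto (hl'.add_const ε) hlz ?_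
      filter_upwards [Ioo_mem_nhdsLT hr] with p hp
      exact hs p ⟨hp.1.le, hp.2.le⟩
    have h1 := h _ h0 l' l hl' hl (by linarith)
    have h2 := hy'.2.2.2.2 _ ⟨hy.2.2.2.1.le, hvv⟩
    linarith [hy.2.2.1]
  have hnull : ∀ n k, P (A n k) = 0 := by
    intro n k
    have h1 : (P.prod P) (A n k ×ˢ A n k) = 0 := by
      rw [measure_eq_zero_iff_ae_notMem]
      filter_upwards [hL, ae_prod_swap hL, hties] with q h3 h4 h5 hq
      rcases lt_trichotomy (touchTime r L q.1 z) (touchTime r L q.2 z) with h | h | h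
      · exact hlt n k _ hq.1 _ hq.2 h h4
      · exact h5 ⟨hq.1.1, h⟩
      · exact hlt n k _ hq.2 _ hq.1 h h3
    rw [Measure.prod_prod] at h1
    exact mul_self_eq_zero.1 h1
  refine measure_mono_null (t := ⋃ n, ⋃ k, A n k) ?_
    (measure_iUnion_null fun n => measure_iUnion_null (hnull n))
  rintro y ⟨h1, h2, h3⟩
  obtain ⟨n, hn⟩ := exists_nat_one_div_lt (sub_pos.2 h2)
  obtain ⟨hr, l, hl, hlz⟩ := leftLim_eq_of_touchTime hrL h1 h2
  obtain ⟨w, hw, h4⟩ := exists_Ioo_lt_of_lt (y := z) (z := y) (a := -(1 / ((n : ℝ) + 1)))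
    (bot_le.trans_lt hr) hlz hl (by linarith [show (0 : ℝ) < 1 / ((n : ℝ) + 1) by positivity])
  obtain ⟨k, hk1, hk2⟩ := exists_denseSeq_between hw
  refine Set.mem_iUnion.2 ⟨n, Set.mem_iUnion.2 ⟨k, h3, h1, by linarith, hk2, fun u hu => ?_⟩⟩
  linarith [h4 u ⟨hk1.trans_le hu.1, hu.2⟩]

/-- If two independent copies touch, in the sense that they or their left limits meet, then at the
first such time the lower one has caught up with the upper one. -/
theorem ae_le_touchTime {P : Measure CadlagPath} [IsProbabilityMeasure P]
    (hJ : NoFixedJump P) (hL : NoStrictLeap P) {r L : ℝ≥0} (hrL : r < L) :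
    ∀ᵐ q ∂P.prod P, touchTime r L q.1 q.2 < L →
      q.2 (touchTime r L q.1 q.2) ≤ q.1 (touchTime r L q.1 q.2) := by
  have key : ∀ (Q : Measure CadlagPath) [IsProbabilityMeasure Q], NoFixedJump Q →
      NoStrictLeap Q → ∀ᵐ q ∂Q.prod Q, ¬ (touchTime r L q.1 q.2 < L ∧
        q.1 (touchTime r L q.1 q.2) < q.2 (touchTime r L q.1 q.2) ∧
        JumpsAt q.1 (touchTime r L q.1 q.2)) := by
    intro Q _ hJ hL
    have hT := measurable_touchTime hrL.le
    have hm : MeasurableSet {q : CadlagPath × CadlagPath | touchTime r L q.1 q.2 < L ∧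
        q.1 (touchTime r L q.1 q.2) < q.2 (touchTime r L q.1 q.2) ∧
        JumpsAt q.1 (touchTime r L q.1 q.2)} :=
      (measurableSet_lt hT measurable_const).inter
        ((measurableSet_lt (measurable_fst.eval_path hT) (measurable_snd.eval_path hT)).inter
          (measurableSet_jumpsAt measurable_fst hT))
    rw [ae_iff]
    simp only [not_not]
    rw [Measure.prod_apply_symm hm, lintegral_eq_zero_iff (measurable_measure_prodMk_right hm)]
    exact Eventually.of_forall fun z => measure_jump_touchTime_eq_zero hJ hL hrL z
  have h2 := ae_prod_map_reflect_iff.1 (key _ hJ.map_reflect hL.map_reflect)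
  filter_upwards [key P hJ hL, h2] with q h3 h4 hT
  simp only [touchTime_reflect, jumpsAt_reflect, CadlagPath.reflect_apply, neg_lt_neg_iff] at h4
  by_contra! hlt
  obtain ⟨hr, l, hl, hl'⟩ := leftLim_eq_of_touchTime hrL hT hlt
  have h0 := bot_le.trans_lt hr
  -- the common left limit differs from at least one of the two values, so one of the copies jumps
  by_cases h5 : l = q.1 (touchTime r L q.1 q.2)
  · exact h4 ⟨hT, hlt, (jumpsAt_iff h0 hl').2 (h5 ▸ hlt.ne)⟩
  · exact h3 ⟨hT, hlt, (jumpsAt_iff h0 hl).2 h5⟩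

/-! ### Almost-continuity in terms of leaps -/

theorem IsAlmostContinuous.noLeap {P : Measure CadlagPath} [IsProbabilityMeasure P]
    (h : IsAlmostContinuous coordProcess P) : NoLeap P := by
  have hpath : Measurable fun (y : CadlagPath) (t : ℝ≥0) => y t :=
    measurable_pi_iff.2 CadlagPath.measurable_apply
  have hcross : ∀ i j : ℕ, ∀ᵐ q ∂P.prod P,
      TopologicalSpace.denseSeq ℝ≥0 i < TopologicalSpace.denseSeq ℝ≥0 j →
      ¬ (q.1 (TopologicalSpace.denseSeq ℝ≥0 i) < q.2 (TopologicalSpace.denseSeq ℝ≥0 i) ∧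
        q.2 (TopologicalSpace.denseSeq ℝ≥0 j) < q.1 (TopologicalSpace.denseSeq ℝ≥0 j) ∧
        ∀ u ∈ Set.Ioo (TopologicalSpace.denseSeq ℝ≥0 i) (TopologicalSpace.denseSeq ℝ≥0 j),
          q.1 u ≠ q.2 u) := by
    intro i j
    by_cases hij : TopologicalSpace.denseSeq ℝ≥0 i < TopologicalSpace.denseSeq ℝ≥0 j
    swap
    · exact Eventually.of_forall fun q h => absurd h hij
    have h1 := h.crossing (CadlagPath × CadlagPath) (P.prod P) (fun t q => q.1 t)
      (fun t q => q.2 t) (fun t => (CadlagPath.measurable_apply t).comp measurable_fst)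
      (fun t => (CadlagPath.measurable_apply t).comp measurable_snd) (fun q => q.1.2)
      (fun q => q.2.2) (indepFun_prod hpath hpath)
      ⟨(hpath.comp measurable_fst).aemeasurable, hpath.aemeasurable, by
        change Measure.map ((fun (y : CadlagPath) (t : ℝ≥0) => y t) ∘ Prod.fst) _ = _
        rw [← Measure.map_map hpath measurable_fst, Measure.map_fst_prod, measure_univ, one_smul]
        rfl⟩
      ⟨(hpath.comp measurable_snd).aemeasurable, hpath.aemeasurable, by
        change Measure.map ((fun (y : CadlagPath) (t : ℝ≥0) => y t) ∘ Prod.snd) _ = _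
        rw [← Measure.map_map hpath measurable_snd, Measure.map_snd_prod, measure_univ, one_smul]
        rfl⟩ _ _ hij
    have h2 := measure_eq_zero_iff_ae_notMem.1 h1
    filter_upwards [h2] with q hq _
    exact hq
  filter_upwards [ae_all_iff.2 fun i => ae_all_iff.2 (hcross i)] with q hq w v hwv h1
  by_contra! h2
  obtain ⟨x, hx, h3⟩ := exists_Ico_lt_of_lt (y := q.2) (z := q.1) (v := v) (a := 0) (by linarith)
  obtain ⟨i, hi1, hi2⟩ := exists_denseSeq_between hwv
  obtain ⟨j, hj1, hj2⟩ := exists_denseSeq_between hx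
  refine hq i j (hi2.trans hj1) ⟨h1 _ ⟨hi1.le, hi2⟩, by simpa using h3 _ ⟨hj1.le, hj2⟩,
    fun u hu => ?_⟩
  rcases lt_or_ge u v with h4 | h4
  · exact (h1 u ⟨(hi1.trans hu.1).le, h4⟩).ne
  · exact (by simpa using h3 u ⟨h4, hu.2.trans hj2⟩ : q.2 u < q.1 u).ne'

/-- The joint law of two independent processes with cadlag paths that are distributed as the
coordinate process under `P` is `P × P`. -/
theorem map_prodMk_eq_prod {P : Measure CadlagPath} [IsProbabilityMeasure P] {Ω : Type*}
    [MeasurableSpace Ω] {Q : Measure Ω} [IsProbabilityMeasure Q] {Y Z : Ω → CadlagPath}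
    (hY : Measurable Y) (hZ : Measurable Z)
    (hYZ : IndepFun (fun ω t => Y ω t) (fun ω t => Z ω t) Q)
    (hYd : IdentDistrib (fun ω t => Y ω t) (fun y t => coordProcess t y) Q P)
    (hZd : IdentDistrib (fun ω t => Z ω t) (fun y t => coordProcess t y) Q P) :
    Q.map (fun ω => (Y ω, Z ω)) = P.prod P := by
  have hpath : Measurable fun (y : CadlagPath) (t : ℝ≥0) => y t :=
    measurable_pi_iff.2 CadlagPath.measurable_apply
  have hcomap : CadlagPath.instMeasurableSpace =
      MeasurableSpace.comap (fun (y : CadlagPath) (t : ℝ≥0) => y t) MeasurableSpace.pi := by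
    rw [MeasurableSpace.pi, MeasurableSpace.comap_iSup, CadlagPath.instMeasurableSpace]
    refine iSup_congr fun t => ?_
    rw [MeasurableSpace.comap_comp]
    rfl
  have hlaw : ∀ {X : Ω → CadlagPath}, Measurable X →
      IdentDistrib (fun ω t => X ω t) (fun y t => coordProcess t y) Q P → Q.map X = P := by
    intro X hX hXd
    ext A hA
    rw [hcomap] at hA
    obtain ⟨B, hB, rfl⟩ := hA
    rw [Measure.map_apply hX (hpath hB)]
    exact hXd.measure_mem_eq hB
  have hind : IndepFun Y Z Q := by
    rw [IndepFun_iff] at hYZ ⊢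
    intro A B hA hB
    rw [hcomap, MeasurableSpace.comap_comp] at hA hB
    exact hYZ A B hA hB
  rw [(indepFun_iff_map_prod_eq_prod_map_map hY.aemeasurable hZ.aemeasurable).1 hind, hlaw hY hYd,
    hlaw hZ hZd]

theorem NoLeap.isAlmostContinuous {P : Measure CadlagPath} [IsProbabilityMeasure P]
    (h : NoLeap P) (hP : ContinuousInProbability coordProcess P) :
    IsAlmostContinuous coordProcess P := by
  refine ⟨fun y => y.2, hP, ?_⟩
  intro Ω _ Q _ Y Z hYm hZm hYc hZc hYZ hYd hZd s t hst
  obtain ⟨Y, rfl⟩ : ∃ Y' : Ω → CadlagPath, Y = fun t ω => Y' ω t :=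
    ⟨fun ω => ⟨fun t => Y t ω, hYc ω⟩, rfl⟩
  obtain ⟨Z, rfl⟩ : ∃ Z' : Ω → CadlagPath, Z = fun t ω => Z' ω t :=
    ⟨fun ω => ⟨fun t => Z t ω, hZc ω⟩, rfl⟩
  have hY : Measurable Y := measurable_toCadlagPath hYm
  have hZ : Measurable Z := measurable_toCadlagPath hZm
  rw [measure_eq_zero_iff_ae_notMem]
  rw [NoLeap, ← map_prodMk_eq_prod hY hZ hYZ hYd hZd] at h
  filter_upwards [ae_of_ae_map (hY.prodMk hZ).aemeasurable h] with ω hω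
  rintro ⟨h1, h2, h3⟩
  generalize Y ω = y at hω h1 h2 h3
  generalize Z ω = z at hω h1 h2 h3
  -- the first time after `s` at which `y` is not below `z`
  set v := sInf {u | s ≤ u ∧ z u ≤ y u} with hv
  have hne : {u | s ≤ u ∧ z u ≤ y u}.Nonempty := ⟨t, hst.le, h2.le⟩
  have hvt : v ≤ t := csInf_le' ⟨hst.le, h2.le⟩
  have hsv : s ≤ v := le_csInf hne fun u hu => hu.1
  have hlt : ∀ u ∈ Set.Ico s v, y u < z u := fun u hu => by
    by_contra! h4
    exact notMem_of_lt_csInf' hu.2 ⟨hu.1, h4⟩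
  have hge : z v ≤ y v := by
    by_contra! h4
    obtain ⟨w, hw, h5⟩ := exists_Ico_lt_of_lt (y := y) (z := z) (v := v) (a := 0) (by linarith)
    refine absurd (le_csInf hne fun u hu => ?_) (not_le.2 hw)
    by_contra! h6
    have h7 := h5 u ⟨csInf_le' hu, h6⟩
    linarith [hu.2]
  have hsv' : s < v := hsv.lt_of_ne fun h4 => by
    rw [← h4] at hge
    linarith
  have heq : y v = z v := (hω s v hsv' hlt).antisymm hge
  rcases hvt.lt_or_eq with h4 | h4
  · exact h3 v ⟨hsv', h4⟩ heq
  · rw [h4] at heq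
    linarith

/-! ### The product inequality as a domination of measures -/

/-- If the ratio of `μ` to `ν` on subsets of `A` never exceeds their ratio on subsets of `B`, then
`μ × ν` is dominated by `ν × μ` on `A × B`: a constant separates the two families of ratios. -/
theorem prod_restrict_le_prod_restrict_swap {Ω : Type*} [MeasurableSpace Ω] {μ ν : Measure Ω}
    [IsFiniteMeasure μ] [IsFiniteMeasure ν] {A₀ B₀ : Set Ω} (hA₀ : MeasurableSet A₀)
    (hB₀ : MeasurableSet B₀)
    (h : ∀ A B, MeasurableSet A → MeasurableSet B → A ⊆ A₀ → B ⊆ B₀ → μ A * ν B ≤ ν A * μ B) :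
    (μ.restrict A₀).prod (ν.restrict B₀) ≤ (ν.restrict A₀).prod (μ.restrict B₀) := by
  by_cases h0 : ν B₀ = 0
  · rw [Measure.restrict_eq_zero.2 h0, Measure.prod_zero]
    exact Measure.zero_le _
  let I := {B : Set Ω // MeasurableSet B ∧ B ⊆ B₀ ∧ ν B ≠ 0}
  let B₁ : I := ⟨B₀, hB₀, subset_rfl, h0⟩
  have : Nonempty I := ⟨B₁⟩
  set ρ : ℝ≥0∞ := ⨅ B : I, μ B.1 / ν B.1 with hρdef
  have hρ : ρ ≠ ∞ := ((iInf_le _ B₁).trans_lt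
    (ENNReal.div_lt_top (measure_ne_top μ _) h0)).ne
  have h1 : μ.restrict A₀ ≤ ρ • ν.restrict A₀ := by
    refine Measure.le_iff.2 fun S hS => ?_
    rw [Measure.smul_apply, Measure.restrict_apply hS, Measure.restrict_apply hS, smul_eq_mul,
      hρdef, ENNReal.iInf_mul fun h => absurd h (measure_ne_top _ _)]
    refine le_iInf fun B => ?_
    rw [div_eq_mul_inv, mul_right_comm, ← div_eq_mul_inv,
      ENNReal.le_div_iff_mul_le (Or.inl B.2.2.2) (Or.inl (measure_ne_top _ _)), mul_comm (μ B.1)]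
    exact h _ _ (hS.inter hA₀) B.2.1 Set.inter_subset_right B.2.2.1
  have h2 : ρ • ν.restrict B₀ ≤ μ.restrict B₀ := by
    refine Measure.le_iff.2 fun S hS => ?_
    rw [Measure.smul_apply, Measure.restrict_apply hS, Measure.restrict_apply hS, smul_eq_mul]
    by_cases h3 : ν (S ∩ B₀) = 0
    · rw [h3, mul_zero]
      exact zero_le
    · rw [← ENNReal.le_div_iff_mul_le (Or.inl h3) (Or.inl (measure_ne_top _ _))]
      exact iInf_le (fun B : I => μ B.1 / ν B.1)
        ⟨S ∩ B₀, hS.inter hB₀, Set.inter_subset_right, h3⟩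
  calc (μ.restrict A₀).prod (ν.restrict B₀)
      ≤ (ρ • ν.restrict A₀).prod (ν.restrict B₀) := Measure.prod_mono h1 le_rfl
    _ = (ν.restrict A₀).prod (ρ • ν.restrict B₀) := by
        rw [Measure.prod_smul_left, Measure.prod_smul_right]
    _ ≤ (ν.restrict A₀).prod (μ.restrict B₀) := Measure.prod_mono le_rfl h2

theorem measure_le_of_restrict_le {Ω ι : Type*} [MeasurableSpace Ω] [Countable ι]
    {μ ν : Measure Ω} {R : ι → Set Ω} (hR : ∀ i, MeasurableSet (R i))
    (h : ∀ i, μ.restrict (R i) ≤ ν.restrict (R i)) {S : Set Ω} (hS : MeasurableSet S)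
    (hSR : S ⊆ ⋃ i, R i) : μ S ≤ ν S := by
  rcases isEmpty_or_nonempty ι with hι | hι
  · rw [Set.subset_empty_iff.1 (by simpa using hSR : S ⊆ ∅), measure_empty]
    exact zero_le
  obtain ⟨f, hf⟩ := exists_surjective_nat ι
  set D := disjointed (R ∘ f) with hD
  have hDm : ∀ n, MeasurableSet (S ∩ D n) := fun n =>
    hS.inter (MeasurableSet.disjointed (fun n => hR (f n)) n)
  have hSD : S = ⋃ n, S ∩ D n := by
    rw [← Set.inter_iUnion, hD, iUnion_disjointed, eq_comm, Set.inter_eq_left]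
    exact hSR.trans_eq (hf.iUnion_comp R).symm
  have hdisj : Pairwise (Function.onFun Disjoint fun n => S ∩ D n) := fun m n hmn =>
    (disjoint_disjointed (R ∘ f) hmn).mono Set.inter_subset_right Set.inter_subset_right
  rw [hSD, measure_iUnion hdisj hDm, measure_iUnion hdisj hDm]
  refine ENNReal.tsum_le_tsum fun n => ?_
  have h1 := h (f n) (S ∩ D n)
  have h2 : S ∩ D n ⊆ R (f n) := Set.inter_subset_right.trans (disjointed_le (R ∘ f) n)
  rwa [Measure.restrict_eq_self _ h2, Measure.restrict_eq_self _ h2] at h1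

/-- The law of the path frozen at `s`, on the event that the path is in `I` at time `t`. -/
noncomputable def freezeLaw (P : Measure CadlagPath) (s t : ℝ≥0) (I : Set ℝ) : Measure CadlagPath :=
  (P.restrict {y | y t ∈ I}).map (CadlagPath.freeze s)

instance isFiniteMeasure_freezeLaw (P : Measure CadlagPath) [IsFiniteMeasure P] (s t : ℝ≥0)
    (I : Set ℝ) : IsFiniteMeasure (freezeLaw P s t I) :=
  inferInstanceAs (IsFiniteMeasure (Measure.map _ _))

theorem freezeLaw_apply (P : Measure CadlagPath) (s t : ℝ≥0) {I : Set ℝ} {A : Set CadlagPath}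
    (hA : MeasurableSet A) :
    freezeLaw P s t I A = P (CadlagPath.freeze s ⁻¹' A ∩ {y | y t ∈ I}) := by
  rw [freezeLaw, Measure.map_apply (CadlagPath.measurable_freeze s) hA,
    Measure.restrict_apply (CadlagPath.measurable_freeze s hA)]

/-- The product inequality for indicator functions `U` and `V`. -/
def SetProductInequality (P : Measure CadlagPath) : Prop :=
  ∀ s t : ℝ≥0, s < t → ∀ a b c d e : ℝ, b < c → c ≤ d → d < e → ∀ A B : Set CadlagPath,
    MeasurableSet A → MeasurableSet B → A ⊆ {y | y s < a} → B ⊆ {y | a < y s} →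
      freezeLaw P s t (Set.Ioo d e) A * freezeLaw P s t (Set.Ioo b c) B ≤
        freezeLaw P s t (Set.Ioo b c) A * freezeLaw P s t (Set.Ioo d e) B

theorem ProductInequality.setProductInequality {P : Measure CadlagPath}
    (h : ProductInequality coordProcess coordFiltration P) : SetProductInequality P := by
  intro s t hst a b c d e hbc hcd hde A B hA hB hAa hBa
  classical
  have key : ∀ {A : Set CadlagPath}, MeasurableSet A → ∀ (S : Set CadlagPath) (I : Set ℝ),
      (∀ y, CadlagPath.freeze s y ∈ A → (y ∈ S ↔ y t ∈ I)) →
      ∫⁻ y in S, (((CadlagPath.freeze s ⁻¹' A).indicator (fun _ => 1) y : ℝ≥0) : ℝ≥0∞) ∂P =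
        freezeLaw P s t I A := by
    intro A hA S I hS
    have hm := CadlagPath.measurable_freeze s hA
    rw [freezeLaw_apply P s t (I := I) hA]
    have h1 : ∀ y : CadlagPath,
        (((CadlagPath.freeze s ⁻¹' A).indicator (fun _ => 1) y : ℝ≥0) : ℝ≥0∞) =
          (CadlagPath.freeze s ⁻¹' A).indicator 1 y := fun y => by
      by_cases hy : y ∈ CadlagPath.freeze s ⁻¹' A <;> simp [hy]
    simp only [h1]
    rw [lintegral_indicator_one hm, Measure.restrict_apply hm]
    congr 1
    ext y
    exact and_congr_right fun hy => hS y hy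
  have hmeas : ∀ {A : Set CadlagPath}, MeasurableSet A → Measurable[coordFiltration s]
      ((CadlagPath.freeze s ⁻¹' A).indicator fun _ => (1 : ℝ≥0)) := fun {A} hA => by
    have : MeasurableSet[coordFiltration s] (CadlagPath.freeze s ⁻¹' A) := by
      rw [coordFiltration_eq_comap_freeze]
      exact ⟨A, hA, rfl⟩
    exact Measurable.indicator (@measurable_const _ _ _ (coordFiltration s) _) this
  have hA' : ∀ y, CadlagPath.freeze s y ∈ A → y s < a := fun y hy => by
    simpa [CadlagPath.freeze_apply] using hAa hy
  have hB' : ∀ y, CadlagPath.freeze s y ∈ B → a < y s := fun y hy => by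
    simpa [CadlagPath.freeze_apply] using hBa hy
  have h1 := h s t hst _ _ (hmeas hA) (hmeas hB) a b c d e hbc hcd hde
  have kA : ∀ x x' : ℝ, _ = freezeLaw P s t (Set.Ioo x x') A := fun x x' =>
    key hA {y | coordProcess s y < a ∧ x < coordProcess t y ∧ coordProcess t y < x'} _
      fun y hy => ⟨fun h => h.2, fun h => ⟨hA' y hy, h⟩⟩
  have kB : ∀ x x' : ℝ, _ = freezeLaw P s t (Set.Ioo x x') B := fun x x' =>
    key hB {y | a < coordProcess s y ∧ x < coordProcess t y ∧ coordProcess t y < x'} _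
      fun y hy => ⟨fun h => h.2, fun h => ⟨hB' y hy, h⟩⟩
  rw [kA, kA, kB, kB] at h1
  exact h1

theorem SetProductInequality.map_reflect {P : Measure CadlagPath} (h : SetProductInequality P) :
    SetProductInequality (P.map CadlagPath.reflect) := by
  intro s t hst a b c d e hbc hcd hde A B hA hB hAa hBa
  have key : ∀ {A : Set CadlagPath}, MeasurableSet A → ∀ a b : ℝ,
      freezeLaw (P.map CadlagPath.reflect) s t (Set.Ioo a b) A =
        freezeLaw P s t (Set.Ioo (-b) (-a)) (CadlagPath.reflect ⁻¹' A) := by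
    intro A hA a b
    have hI : MeasurableSet {y : CadlagPath | y t ∈ Set.Ioo a b} :=
      CadlagPath.measurable_apply t measurableSet_Ioo
    rw [freezeLaw_apply _ s t (I := Set.Ioo a b) hA,
      freezeLaw_apply _ s t (I := Set.Ioo (-b) (-a)) (CadlagPath.measurable_reflect hA),
      Measure.map_apply CadlagPath.measurable_reflect
        ((CadlagPath.measurable_freeze s hA).inter hI)]
    congr 1
    ext y
    refine and_congr Iff.rfl ?_
    simp only [Set.mem_ofPred_eq, CadlagPath.reflect_apply, Set.mem_Ioo]
    constructor <;> rintro ⟨h1, h2⟩ <;> constructor <;> linarith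
  rw [key hA, key hA, key hB, key hB]
  refine (mul_comm _ _).trans_le ((h s t hst (-a) (-e) (-d) (-c) (-b) (neg_lt_neg hde)
    (neg_le_neg hcd) (neg_lt_neg hbc) _ _ (CadlagPath.measurable_reflect hB)
    (CadlagPath.measurable_reflect hA) (fun y hy => ?_) (fun y hy => ?_)).trans_eq (mul_comm _ _))
  · have := hBa hy
    simp only [Set.mem_ofPred_eq, CadlagPath.reflect_apply] at this ⊢
    linarith
  · have := hAa hy
    simp only [Set.mem_ofPred_eq, CadlagPath.reflect_apply] at this ⊢
    linarith

/-- The product inequality for events of the past of both copies together: exchanging the values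
of the two copies at time `t` makes an event more probable if it puts them in the same order as at
time `s`. -/
theorem SetProductInequality.measure_prod_le {P : Measure CadlagPath} [IsProbabilityMeasure P]
    (h : SetProductInequality P) {s t : ℝ≥0} (hst : s < t) {b c d e : ℝ} (hbc : b < c)
    (hcd : c ≤ d) (hde : d < e) {S : Set (CadlagPath × CadlagPath)} (hS : MeasurableSet S)
    (hfreeze : ∀ q, (q.1.freeze s, q.2.freeze s) ∈ S ↔ q ∈ S) (hlt : ∀ q ∈ S, q.1 s < q.2 s) :
    (P.prod P) (S ∩ {q | q.1 t ∈ Set.Ioo d e ∧ q.2 t ∈ Set.Ioo b c}) ≤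
      (P.prod P) (S ∩ {q | q.1 t ∈ Set.Ioo b c ∧ q.2 t ∈ Set.Ioo d e}) := by
  have key : ∀ a₁ b₁ a₂ b₂ : ℝ,
      (P.prod P) (S ∩ {q | q.1 t ∈ Set.Ioo a₁ b₁ ∧ q.2 t ∈ Set.Ioo a₂ b₂}) =
        ((freezeLaw P s t (Set.Ioo a₁ b₁)).prod (freezeLaw P s t (Set.Ioo a₂ b₂))) S := by
    intro a₁ b₁ a₂ b₂
    have hm : Measurable (Prod.map (CadlagPath.freeze s) (CadlagPath.freeze s)) :=
      (CadlagPath.measurable_freeze s).prodMap (CadlagPath.measurable_freeze s)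
    rw [freezeLaw, freezeLaw, Measure.map_prod_map _ _ (CadlagPath.measurable_freeze s)
      (CadlagPath.measurable_freeze s), Measure.map_apply hm hS, Measure.prod_restrict,
      Measure.restrict_apply (hm hS)]
    congr 1
    ext q
    exact and_congr (hfreeze q).symm Iff.rfl
  rw [key, key]
  refine measure_le_of_restrict_le (ι := ℚ)
    (R := fun a => {y : CadlagPath | y s < a} ×ˢ {z : CadlagPath | (a : ℝ) < z s})
    (fun a => ?_) (fun a => ?_) hS fun q hq => ?_
  · exact (measurableSet_lt (CadlagPath.measurable_apply s) measurable_const).prod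
      (measurableSet_lt measurable_const (CadlagPath.measurable_apply s))
  · rw [← Measure.prod_restrict, ← Measure.prod_restrict]
    exact prod_restrict_le_prod_restrict_swap
      (measurableSet_lt (CadlagPath.measurable_apply s) measurable_const)
      (measurableSet_lt measurable_const (CadlagPath.measurable_apply s))
      fun A B hA hB => h s t hst a b c d e hbc hcd hde A B hA hB
  · obtain ⟨a, ha1, ha2⟩ := exists_rat_btwn (hlt q hq)
    exact Set.mem_iUnion.2 ⟨a, ha1, ha2⟩

/-! ### Exchanging crossings along grids -/

theorem measure_liminf_le_measure_limsup {Ω : Type*} [MeasurableSpace Ω] {μ : Measure Ω}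
    [IsFiniteMeasure μ] {A B : ℕ → Set Ω} (hB : ∀ n, MeasurableSet (B n))
    (h : ∀ n, μ (A n) ≤ μ (B n)) :
    μ (⋃ N, ⋂ n ≥ N, A n) ≤ μ (⋂ N, ⋃ n ≥ N, B n) := by
  have h1 : Monotone fun N => ⋂ n ≥ N, A n := fun M N hMN =>
    Set.biInter_subset_biInter_left fun n (hn : N ≤ n) => hMN.trans hn
  have h2 : Antitone fun N => ⋃ n ≥ N, B n := fun M N hMN =>
    Set.biUnion_subset_biUnion_left fun n (hn : N ≤ n) => hMN.trans hn
  rw [h1.measure_iUnion, h2.measure_iInter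
    (fun N => (MeasurableSet.biUnion (Set.to_countable _) fun n _ => hB n).nullMeasurableSet)
    ⟨0, measure_ne_top _ _⟩]
  refine iSup_le fun N => le_iInf fun M => ?_
  calc μ (⋂ n ≥ N, A n) ≤ μ (A (max N M)) :=
        measure_mono (Set.biInter_subset_of_mem (le_max_left N M))
    _ ≤ μ (B (max N M)) := h _
    _ ≤ μ (⋃ n ≥ M, B n) :=
        measure_mono (Set.subset_biUnion_of_mem (u := B) (le_max_right N M : max N M ≥ M))

/-- The grid of mesh `1 / (n + 1)` that starts at `r`. -/
noncomputable def gridTime (r : ℝ≥0) (n k : ℕ) : ℝ≥0 := r + k / ((n : ℝ≥0) + 1)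

theorem gridTime_mono (r : ℝ≥0) (n : ℕ) : Monotone (gridTime r n) := fun j k h => by
  unfold gridTime
  gcongr

theorem gridTime_succ (r : ℝ≥0) (n k : ℕ) :
    gridTime r n (k + 1) = gridTime r n k + 1 / ((n : ℝ≥0) + 1) := by
  rw [gridTime, gridTime, Nat.cast_add, Nat.cast_one, add_div, add_assoc]

theorem gridTime_lt_succ (r : ℝ≥0) (n k : ℕ) : gridTime r n k < gridTime r n (k + 1) := by
  rw [gridTime_succ]
  exact lt_add_of_pos_right _ (by positivity)

theorem le_gridTime (r : ℝ≥0) (n k : ℕ) : r ≤ gridTime r n k := le_self_add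

theorem gridTime_le {r : ℝ≥0} {n k L : ℕ} (h : k ≤ L * (n + 1)) : gridTime r n k ≤ r + L := by
  refine add_le_add_right (div_le_of_le_mul₀ (by positivity) (by positivity) ?_) r
  exact_mod_cast h

theorem exists_gridTime_lt_le {r v : ℝ≥0} {L : ℕ} (hr : r < v) (hv : v < r + L) (n : ℕ) :
    ∃ i < L * (n + 1), gridTime r n i < v ∧ v ≤ gridTime r n (i + 1) := by
  have hn : (0 : ℝ≥0) < (n : ℝ≥0) + 1 := by positivity
  have hpos : 0 < (v - r) * ((n : ℝ≥0) + 1) := mul_pos (tsub_pos_of_lt hr) hn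
  obtain ⟨i, hi⟩ : ∃ i, ⌈(v - r) * ((n : ℝ≥0) + 1)⌉₊ = i + 1 :=
    Nat.exists_eq_succ_of_ne_zero (Nat.ceil_pos.2 hpos).ne'
  refine ⟨i, ?_, ?_, ?_⟩
  · have h1 : ⌈(v - r) * ((n : ℝ≥0) + 1)⌉₊ ≤ L * (n + 1) := by
      refine Nat.ceil_le.2 ?_
      push_cast
      gcongr
      exact tsub_le_iff_left.2 hv.le
    omega
  · have h1 : (i : ℝ≥0) < (v - r) * ((n : ℝ≥0) + 1) := Nat.lt_ceil.1 (by omega)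
    have h2 := (div_lt_iff₀ hn).2 h1
    exact lt_tsub_iff_left.1 h2
  · have h1 := Nat.le_ceil ((v - r) * ((n : ℝ≥0) + 1))
    rw [hi] at h1
    exact tsub_le_iff_left.1 ((le_div_iff₀ hn).2 h1)

section Exchange

variable {P : Measure CadlagPath} [IsProbabilityMeasure P]

/-- The event that at time `gridTime r n i` the two paths are separated since time `r`, the upper
path has been in `(b, c)` at all grid times, and the pair of values is in `O`. -/
def gridPast (r : ℝ≥0) (n i : ℕ) (b c : ℝ) (O : Set (ℝ × ℝ)) : Set (CadlagPath × CadlagPath) :=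
  {q | Separated r (gridTime r n i) q.1 q.2 ∧ (∀ j ≤ i, q.2 (gridTime r n j) ∈ Set.Ioo b c) ∧
    (q.1 (gridTime r n i), q.2 (gridTime r n i)) ∈ O}

/-- The event that at the first grid time after `gridPast` the values of the two paths are in
`I` and `J`. -/
def gridStep (r : ℝ≥0) (n L : ℕ) (b c : ℝ) (O : Set (ℝ × ℝ)) (I J : Set ℝ) :
    Set (CadlagPath × CadlagPath) :=
  ⋃ i ∈ Finset.range (L * (n + 1)), gridPast r n i b c O ∩
    {q | q.1 (gridTime r n (i + 1)) ∈ I ∧ q.2 (gridTime r n (i + 1)) ∈ J}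

theorem measurable_fst_apply (t : ℝ≥0) :
    Measurable fun q : CadlagPath × CadlagPath => q.1 t :=
  (CadlagPath.measurable_apply t).comp measurable_fst

theorem measurable_snd_apply (t : ℝ≥0) :
    Measurable fun q : CadlagPath × CadlagPath => q.2 t :=
  (CadlagPath.measurable_apply t).comp measurable_snd

theorem measurableSet_gridPast (r : ℝ≥0) (n i : ℕ) (b c : ℝ) {O : Set (ℝ × ℝ)}
    (hO : MeasurableSet O) : MeasurableSet (gridPast r n i b c O) := by
  refine (measurableSet_separated _ _).inter (MeasurableSet.inter ?_ ?_)
  · change MeasurableSet {q : CadlagPath × CadlagPath |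
      ∀ j ≤ i, q.2 (gridTime r n j) ∈ Set.Ioo b c}
    simp only [Set.ofPred_forall]
    exact MeasurableSet.iInter fun j => MeasurableSet.iInter fun _ =>
      measurable_snd_apply _ measurableSet_Ioo
  · exact ((measurable_fst_apply _).prodMk (measurable_snd_apply _)) hO

theorem measurableSet_apply_mem (t : ℝ≥0) {I J : Set ℝ} (hI : MeasurableSet I)
    (hJ : MeasurableSet J) :
    MeasurableSet {q : CadlagPath × CadlagPath | q.1 t ∈ I ∧ q.2 t ∈ J} :=
  (measurable_fst_apply t hI).inter (measurable_snd_apply t hJ)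

theorem measurableSet_gridStep (r : ℝ≥0) (n L : ℕ) (b c : ℝ) {O : Set (ℝ × ℝ)}
    (hO : MeasurableSet O) {I J : Set ℝ} (hI : MeasurableSet I) (hJ : MeasurableSet J) :
    MeasurableSet (gridStep r n L b c O I J) :=
  Finset.measurableSet_biUnion _ fun _ _ => (measurableSet_gridPast _ _ _ _ _ hO).inter
    (measurableSet_apply_mem _ hI hJ)

/-- The product inequality at each grid time. The events on the right are disjoint for different
grid times, since the upper path leaves `(b, c)` at the end of the step. -/
theorem SetProductInequality.measure_gridStep_le (h : SetProductInequality P) {b c d e : ℝ}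
    (hbc : b < c) (hcd : c ≤ d) (hde : d < e) (r : ℝ≥0) (n L : ℕ) {O : Set (ℝ × ℝ)}
    (hO : MeasurableSet O) :
    (P.prod P) (gridStep r n L b c O (Set.Ioo d e) (Set.Ioo b c)) ≤
      (P.prod P) (gridStep r n L b c O (Set.Ioo b c) (Set.Ioo d e)) := by
  unfold gridStep
  rw [measure_biUnion_finset (μ := P.prod P) (f := fun i => gridPast r n i b c O ∩
    {q | q.1 (gridTime r n (i + 1)) ∈ Set.Ioo b c ∧ q.2 (gridTime r n (i + 1)) ∈ Set.Ioo d e})]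
  · refine (measure_biUnion_finset_le _ _).trans (Finset.sum_le_sum fun i _ => ?_)
    refine h.measure_prod_le (gridTime_lt_succ r n i) hbc hcd hde
      (measurableSet_gridPast r n i b c hO) (fun q => ?_) fun q hq =>
        hq.1.lt ⟨le_gridTime _ _ _, le_rfl⟩
    refine and_congr (separated_congr (fun p hp => CadlagPath.freeze_apply_of_le _ hp)
      fun p hp => CadlagPath.freeze_apply_of_le _ hp) (and_congr (forall₂_congr fun j hj => ?_) ?_)
    · rw [CadlagPath.freeze_apply_of_le _ (gridTime_mono r n hj)]
    · rw [CadlagPath.freeze_apply_of_le _ le_rfl, CadlagPath.freeze_apply_of_le _ le_rfl]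
  · have key : ∀ i j, i < j → ∀ q : CadlagPath × CadlagPath,
        q.2 (gridTime r n (i + 1)) ∈ Set.Ioo d e → q ∈ gridPast r n j b c O → False := by
      intro i j hij q h1 h2
      have h3 := h2.2.1 (i + 1) hij
      exact absurd (h3.2.trans_le hcd) (not_lt.2 h1.1.le)
    intro i _ j _ hij
    refine Set.disjoint_left.2 fun q hi hj => ?_
    rcases hij.lt_or_gt with h1 | h1
    · exact key i j h1 q hi.2.2 hj.1
    · exact key j i h1 q hj.2.2 hi.1
  · exact fun i _ => (measurableSet_gridPast r n i b c hO).inter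
      (measurableSet_apply_mem _ measurableSet_Ioo measurableSet_Ioo)

/-- Two paths, separated on `[r, v)`, such that the upper one jumps up over `[c, d]` at time `v`
while the lower one is then in `[b, c]`, and that the pair of values is in each of the sets `O m` at
times that accumulate at `v` from the left. -/
def UpperJump (r : ℝ≥0) (b c d : ℝ) (O : ℕ → Set (ℝ × ℝ)) (q : CadlagPath × CadlagPath) : Prop :=
  ∃ v > r, (∀ u < v, Separated r u q.1 q.2) ∧ (∀ l, Tendsto q.2 (𝓝[<] v) (𝓝 l) → l ≤ c) ∧
    d ≤ q.2 v ∧ q.1 v ∈ Set.Icc b c ∧ ∀ m, ∃ᶠ u in 𝓝[<] v, (q.1 u, q.2 u) ∈ O m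

/-- Two paths, separated on `[r, v)`, such that the lower one jumps over the upper one into `(d, e)`
at time `v` while the upper one stays in `(b, c)`, and that the pair of values is in each of the
sets `O m` just before `v`. -/
def LowerLeap (r : ℝ≥0) (L : ℕ) (b c d e : ℝ) (O : ℕ → Set (ℝ × ℝ))
    (q : CadlagPath × CadlagPath) : Prop :=
  ∃ v > r, v < r + L ∧ (∀ u < v, Separated r u q.1 q.2) ∧ (∀ u ∈ Set.Icc r v, q.2 u ∈ Set.Ioo b c) ∧
    q.1 v ∈ Set.Ioo d e ∧ ∀ m, ∀ᶠ u in 𝓝[<] v, (q.1 u, q.2 u) ∈ O m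

theorem LowerLeap.mem_gridStep {r : ℝ≥0} {L : ℕ} {b c d e : ℝ} {O : ℕ → Set (ℝ × ℝ)}
    {q : CadlagPath × CadlagPath} (h : LowerLeap r L b c d e O q) (m : ℕ) :
    ∃ N, ∀ n ≥ N, q ∈ gridStep r n L b c (O m) (Set.Ioo d e) (Set.Ioo b c) := by
  obtain ⟨v, hrv, hvL, hs, hz, hy, hO⟩ := h
  obtain ⟨w, hw, h1⟩ := (mem_nhdsLT_iff_exists_Ioo_subset' hrv).1 (hO m)
  have h2 : ∀ᶠ u in 𝓝[≥] v, q.1 u ∈ Set.Ioo d e ∧ q.2 u ∈ Set.Ioo b c :=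
    ((q.1.continuousWithinAt_Ici v).eventually_mem (Ioo_mem_nhds hy.1 hy.2)).and
      ((q.2.continuousWithinAt_Ici v).eventually_mem
        (Ioo_mem_nhds (hz v ⟨hrv.le, le_rfl⟩).1 (hz v ⟨hrv.le, le_rfl⟩).2))
  obtain ⟨w', hw', h3⟩ := mem_nhdsGE_iff_exists_Ico_subset.1 h2
  have h0 : Tendsto (fun n : ℕ => 1 / ((n : ℝ≥0) + 1)) atTop (𝓝 0) :=
    tendsto_one_div_add_atTop_nhds_zero_nat
  have h4 : ∀ᶠ n : ℕ in atTop, 1 / ((n : ℝ≥0) + 1) < min (v - w) (w' - v) :=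
    h0.eventually_lt_const (lt_min (tsub_pos_of_lt hw) (tsub_pos_of_lt hw'))
  obtain ⟨N, hN⟩ := eventually_atTop.1 h4
  refine ⟨N, fun n hn => ?_⟩
  obtain ⟨i, hi, h5, h6⟩ := exists_gridTime_lt_le hrv hvL n
  have h7 := lt_tsub_iff_left.1 ((hN n hn).trans_le (min_le_left _ _))
  have h8 := lt_tsub_iff_left.1 ((hN n hn).trans_le (min_le_right _ _))
  have h9 : w < gridTime r n i := by
    rw [gridTime_succ] at h6
    exact lt_of_add_lt_add_right (h7.trans_le h6)
  have h10 : gridTime r n (i + 1) < w' := by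
    rw [gridTime_succ]
    exact (add_lt_add_left h5 _).trans h8
  exact Set.mem_biUnion (Finset.mem_coe.2 (Finset.mem_range.2 hi)) ⟨⟨hs _ h5, fun j hj =>
    hz _ ⟨le_gridTime _ _ _, ((gridTime_mono r n hj).trans h5.le)⟩, h1 ⟨h9, h5⟩⟩, h3 ⟨h6, h10⟩⟩

theorem upperJump_of_mem_gridStep {r : ℝ≥0} {L : ℕ} {b c d e : ℝ} (hcd : c < d)
    {O : ℕ → Set (ℝ × ℝ)} (hO : Antitone O) {q : CadlagPath × CadlagPath}
    (h : ∀ m N, ∃ n ≥ N, q ∈ gridStep r n L b c (O m) (Set.Ioo b c) (Set.Ioo d e)) :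
    UpperJump r b c d O q := by
  -- along a diagonal sequence of grids, the steps `[u k, u' k]` shrink to a point `v`
  choose n hn hq using fun k => h k k
  simp only [gridStep, Set.mem_iUnion, Finset.mem_range] at hq
  choose i hi hq using hq
  set u : ℕ → ℝ≥0 := fun k => gridTime r (n k) (i k) with hu
  set u' : ℕ → ℝ≥0 := fun k => gridTime r (n k) (i k + 1) with hu'
  have hsep : ∀ k, Separated r (u k) q.1 q.2 := fun k => (hq k).1.1
  have hzu : ∀ k, q.2 (u k) ∈ Set.Ioo b c := fun k => (hq k).1.2.1 _ le_rfl
  have hOu : ∀ k, (q.1 (u k), q.2 (u k)) ∈ O k := fun k => (hq k).1.2.2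
  have hyu' : ∀ k, q.1 (u' k) ∈ Set.Ioo b c := fun k => (hq k).2.1
  have hzu' : ∀ k, q.2 (u' k) ∈ Set.Ioo d e := fun k => (hq k).2.2
  have hlt : ∀ k, u k < u' k := fun k => gridTime_lt_succ _ _ _
  obtain ⟨v, -, φ, hφ, huv⟩ := isCompact_Icc.tendsto_subseq (x := u) (s := Set.Icc r (r + L))
    fun k => ⟨le_gridTime _ _ _, gridTime_le (hi k).le⟩
  have hu'v : Tendsto (u' ∘ φ) atTop (𝓝 v) := by
    have h0 : Tendsto (fun n : ℕ => 1 / ((n : ℝ≥0) + 1)) atTop (𝓝 0) :=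
      tendsto_one_div_add_atTop_nhds_zero_nat
    have h1 : Tendsto n atTop atTop := tendsto_atTop_mono hn tendsto_id
    have h2 := huv.add (h0.comp (h1.comp hφ.tendsto_atTop))
    rw [add_zero] at h2
    exact h2.congr fun k => (gridTime_succ _ _ _).symm
  have h1 : ∀ᶠ k in atTop, u (φ k) < v := by
    by_contra h2
    have h3 : ∃ᶠ k in atTop, v ≤ u (φ k) := by simpa only [Filter.Frequently, not_le] using h2
    set G := (atTop : Filter ℕ) ⊓ 𝓟 {k | v ≤ u (φ k)}
    have hG : G.NeBot := frequently_mem_iff_neBot.1 h3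
    have h4 : ∀ᶠ k in G, v ≤ u (φ k) := mem_inf_of_right (mem_principal_self _)
    have h5 : Tendsto (u ∘ φ) G (𝓝[≥] v) :=
      tendsto_nhdsWithin_iff.2 ⟨huv.mono_left inf_le_left, h4⟩
    have h6 : Tendsto (u' ∘ φ) G (𝓝[≥] v) :=
      tendsto_nhdsWithin_iff.2 ⟨hu'v.mono_left inf_le_left, h4.mono fun k hk =>
        hk.trans (hlt _).le⟩
    have h7 := le_of_tendsto ((q.2.continuousWithinAt_Ici v).tendsto.comp h5)
      (Eventually.of_forall fun k => (hzu (φ k)).2.le)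
    have h8 := ge_of_tendsto ((q.2.continuousWithinAt_Ici v).tendsto.comp h6)
      (Eventually.of_forall fun k => (hzu' (φ k)).1.le)
    linarith
  obtain ⟨l, hl⟩ := q.2.exists_leftLim v
  have h2 : Tendsto (u ∘ φ) atTop (𝓝[<] v) := tendsto_nhdsWithin_iff.2 ⟨huv, h1⟩
  have hlc : l ≤ c := le_of_tendsto (hl.comp h2) (Eventually.of_forall fun k => (hzu (φ k)).2.le)
  have h3 : ∀ᶠ k in atTop, v ≤ u' (φ k) := by
    by_contra h4
    have h5 : ∃ᶠ k in atTop, u' (φ k) < v := by simpa only [Filter.Frequently, not_lt] using h4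
    set G := (atTop : Filter ℕ) ⊓ 𝓟 {k | u' (φ k) < v}
    have hG : G.NeBot := frequently_mem_iff_neBot.1 h5
    have h6 : ∀ᶠ k in G, u' (φ k) < v := mem_inf_of_right (mem_principal_self _)
    have h7 : Tendsto (u' ∘ φ) G (𝓝[<] v) :=
      tendsto_nhdsWithin_iff.2 ⟨hu'v.mono_left inf_le_left, h6⟩
    have h8 := ge_of_tendsto (hl.comp h7) (Eventually.of_forall fun k => (hzu' (φ k)).1.le)
    linarith
  have h4 : Tendsto (u' ∘ φ) atTop (𝓝[≥] v) := tendsto_nhdsWithin_iff.2 ⟨hu'v, h3⟩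
  have hne : (𝓝[<] v).NeBot := h2.neBot
  obtain ⟨k, hk⟩ := h1.exists
  refine ⟨v, (le_gridTime _ _ _).trans_lt hk, fun w hw => ?_, fun l' hl' => ?_, ?_, ?_, fun m => ?_⟩
  · obtain ⟨k, hk⟩ := (huv.eventually_const_lt hw).exists
    exact (hsep (φ k)).mono hk.le
  · rwa [tendsto_nhds_unique hl' hl]
  · exact ge_of_tendsto ((q.2.continuousWithinAt_Ici v).tendsto.comp h4)
      (Eventually.of_forall fun k => (hzu' (φ k)).1.le)
  · have h5 := (q.1.continuousWithinAt_Ici v).tendsto.comp h4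
    exact ⟨ge_of_tendsto h5 (Eventually.of_forall fun k => (hyu' (φ k)).1.le),
      le_of_tendsto h5 (Eventually.of_forall fun k => (hyu' (φ k)).2.le)⟩
  · refine h2.frequently (Eventually.frequently ?_)
    filter_upwards [eventually_ge_atTop m] with k hk
    exact hO (hk.trans (hφ.id_le k)) (hOu (φ k))

/-- Under the product inequality, leaps of the lower path over the upper one are at most as likely
as the configurations that arise from exchanging the two paths at the time of the leap. -/
theorem SetProductInequality.ae_not_lowerLeap (h : SetProductInequality P) {b c d e : ℝ}
    (hbc : b < c) (hcd : c < d) (hde : d < e) (r : ℝ≥0) (L : ℕ) {O : ℕ → Set (ℝ × ℝ)}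
    (hOm : ∀ m, MeasurableSet (O m)) (hO : Antitone O)
    (hU : ∀ᵐ q ∂P.prod P, ¬ UpperJump r b c d O q) :
    ∀ᵐ q ∂P.prod P, ¬ LowerLeap r L b c d e O q := by
  set F : ℕ → Set (CadlagPath × CadlagPath) := fun m =>
    ⋂ N, ⋃ n ≥ N, gridStep r n L b c (O m) (Set.Ioo b c) (Set.Ioo d e) with hF
  have hgm : ∀ m n, MeasurableSet (gridStep r n L b c (O m) (Set.Ioo b c) (Set.Ioo d e)) :=
    fun m n => measurableSet_gridStep r n L b c (hOm m) measurableSet_Ioo measurableSet_Ioo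
  have hFm : ∀ m, MeasurableSet (F m) := fun m => MeasurableSet.iInter fun N =>
    MeasurableSet.biUnion (Set.to_countable _) fun n _ => hgm m n
  have hFanti : Antitone F := fun m m' hm => Set.iInter_mono fun N => Set.iUnion₂_mono fun n _ =>
    Set.iUnion₂_mono fun i _ => Set.inter_subset_inter_left _ fun q hq =>
      ⟨hq.1, hq.2.1, hO hm hq.2.2⟩
  have hle : ∀ m, (P.prod P) {q | LowerLeap r L b c d e O q} ≤ (P.prod P) (F m) := fun m => by
    refine le_trans (measure_mono fun q hq => ?_) (measure_liminf_le_measure_limsup (hgm m) fun n =>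
      h.measure_gridStep_le hbc hcd.le hde r n L (hOm m))
    obtain ⟨N, hN⟩ := LowerLeap.mem_gridStep hq m
    exact Set.mem_iUnion.2 ⟨N, Set.mem_iInter₂.2 hN⟩
  have h0 : (P.prod P) (⋂ m, F m) = 0 := by
    rw [measure_eq_zero_iff_ae_notMem]
    filter_upwards [hU] with q hq hqF
    refine hq (upperJump_of_mem_gridStep (L := L) (e := e) hcd hO fun m N => ?_)
    have h1 := Set.mem_iInter.1 (Set.mem_iInter.1 hqF m) N
    obtain ⟨n, hn, h2⟩ := Set.mem_iUnion₂.1 h1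
    exact ⟨n, hn, h2⟩
  rw [hFanti.measure_iInter (fun m => (hFm m).nullMeasurableSet) ⟨0, measure_ne_top _ _⟩] at h0
  rw [ae_iff]
  simp only [not_not]
  exact le_antisymm ((le_iInf hle).trans_eq h0) zero_le

end Exchange

/-! ### The product inequality excludes leaps -/

section LeapExclusion

variable {P : Measure CadlagPath} [IsProbabilityMeasure P]

/-- No leap from a strictly lower left limit over a path that is continuous at that time: exchanging
the paths would make both of them jump at the same time. -/
theorem SetProductInequality.ae_le_of_leftLim_lt (h : SetProductInequality P)
    (hJ : NoFixedJump P) :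
    ∀ᵐ q ∂P.prod P, ∀ v, 0 < v → ∀ l < q.2 v, Tendsto q.1 (𝓝[<] v) (𝓝 l) →
      Tendsto q.2 (𝓝[<] v) (𝓝 (q.2 v)) → q.1 v ≤ q.2 v := by
  have key : ∀ (k L : ℕ) (a b c d e : ℚ), ∀ᵐ q ∂P.prod P,
      a < b → b < c → c < d → d < e →
      ¬ LowerLeap (TopologicalSpace.denseSeq ℝ≥0 k) L b c d e (fun _ => {p | p.1 < (a : ℝ)}) q := by
    intro k L a b c d e
    by_cases hlt : a < b ∧ b < c ∧ c < d ∧ d < e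
    swap
    · exact Eventually.of_forall fun q h1 h2 h3 h4 => absurd ⟨h1, h2, h3, h4⟩ hlt
    obtain ⟨hab, hbc, hcd, hde⟩ := hlt
    have hab' : (a : ℝ) < b := by exact_mod_cast hab
    have hcd' : (c : ℝ) < d := by exact_mod_cast hcd
    have h1 := h.ae_not_lowerLeap (b := b) (c := c) (d := d) (e := e) (by exact_mod_cast hbc)
      hcd' (by exact_mod_cast hde) (TopologicalSpace.denseSeq ℝ≥0 k) L
      (O := fun _ => {p | p.1 < (a : ℝ)})
      (fun _ => measurableSet_lt measurable_fst measurable_const) antitone_const ?_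
    · filter_upwards [h1] with q hq _ _ _ _
      exact hq
    filter_upwards [ae_not_common_jump hJ] with q hq
    rintro ⟨v, hv, -, hz, hzv, hyv, hO⟩
    have hv0 : 0 < v := bot_le.trans_lt hv
    obtain ⟨l, hl⟩ := q.1.exists_leftLim v
    obtain ⟨l', hl'⟩ := q.2.exists_leftLim v
    refine hq v ⟨(jumpsAt_iff hv0 hl).2 fun h2 => ?_, (jumpsAt_iff hv0 hl').2 fun h2 => ?_⟩
    · have h3 : ∀ᶠ u in 𝓝[<] v, (a : ℝ) < q.1 u :=
        hl.eventually_const_lt (by rw [h2]; exact hab'.trans_le hyv.1)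
      obtain ⟨u, hu, hu'⟩ := ((hO 0).and_eventually h3).exists
      exact lt_asymm hu hu'
    · have := hz l' hl'
      linarith
  filter_upwards [ae_all_iff.2 fun k => ae_all_iff.2 fun L => ae_all_iff.2 fun a =>
    ae_all_iff.2 fun b => ae_all_iff.2 fun c => ae_all_iff.2 fun d =>
    ae_all_iff.2 (key k L a b c d)]
    with q hq v hv l hl hy hz
  by_contra! hlt
  obtain ⟨a, ha1, ha2⟩ := exists_rat_btwn hl
  obtain ⟨b, hb1, hb2⟩ := exists_rat_btwn ha2
  obtain ⟨c, hc1, hc2⟩ := exists_rat_btwn hlt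
  obtain ⟨d, hd1, hd2⟩ := exists_rat_btwn hc2
  obtain ⟨e, he1, -⟩ := exists_rat_btwn (lt_add_one (q.1 v))
  obtain ⟨L, hL⟩ := exists_nat_gt v
  have h1 : ∀ᶠ u in 𝓝[<] v, q.2 u ∈ Set.Ioo (b : ℝ) c := hz.eventually_mem (Ioo_mem_nhds hb2 hc1)
  obtain ⟨w, hw, h2⟩ := (mem_nhdsLT_iff_exists_Ioo_subset' hv).1 h1
  obtain ⟨w', hw', h3⟩ := exists_Ioo_lt_of_lt (a := (q.2 v - l) / 2) hv hy hz (by linarith)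
  obtain ⟨k, hk1, hk2⟩ := exists_denseSeq_between (max_lt hw hw')
  refine hq k L a b c d e (by exact_mod_cast hb1) (by exact_mod_cast hb2.trans hc1)
    (by exact_mod_cast hd1) (by exact_mod_cast hd2.trans he1)
    ⟨v, hk2, hL.trans_le le_add_self, fun u hu => ?_, fun u hu => ?_, ⟨hd2, he1⟩, fun _ => ?_⟩
  · exact ⟨(q.2 v - l) / 2, by linarith, fun p hp => (h3 p
      ⟨(le_max_right _ _).trans_lt (hk1.trans_le hp.1), hp.2.trans_lt hu⟩).le⟩
  · rcases hu.2.lt_or_eq with h4 | rfl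
    · exact h2 ⟨(le_max_left _ _).trans_lt (hk1.trans_le hu.1), h4⟩
    · exact ⟨hb2, hc1⟩
  · exact hy.eventually_lt_const ha1

/-- Since the two copies have no common jumps, one of them is continuous at the time of a leap. If
it is the lower one, the reflected pair is in the situation of the previous lemma. -/
theorem SetProductInequality.noStrictLeap (h : SetProductInequality P) (hJ : NoFixedJump P) :
    NoStrictLeap P := by
  have h2 := ae_prod_map_reflect_iff.1 (h.map_reflect.ae_le_of_leftLim_lt hJ.map_reflect)
  filter_upwards [h.ae_le_of_leftLim_lt hJ, h2, ae_not_common_jump hJ]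
    with q h3 h4 h5 v hv l l' hl hl' hll
  have h6 := h5 v
  rw [jumpsAt_iff hv hl, jumpsAt_iff hv hl', not_and_or, not_not, not_not] at h6
  rcases h6 with rfl | rfl
  · exact neg_le_neg_iff.1 (h4 v hv (-l') (neg_lt_neg hll) hl'.neg hl.neg)
  · exact h3 v hv l hll hl hl'

/-- No leap from a common left limit over a path that is continuous at that time: exchanging the
paths would make the upper one jump away from the lower one as they touch. -/
theorem SetProductInequality.ae_le_of_leftLim_eq (h : SetProductInequality P)
    (hJ : NoFixedJump P) :
    ∀ᵐ q ∂P.prod P, ∀ w v, w < v → (∀ u ∈ Set.Ico w v, q.1 u < q.2 u) →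
      Tendsto q.1 (𝓝[<] v) (𝓝 (q.2 v)) → Tendsto q.2 (𝓝[<] v) (𝓝 (q.2 v)) → q.1 v ≤ q.2 v := by
  have htouch : ∀ᵐ q ∂P.prod P, ∀ k M : ℕ,
      touchTime (TopologicalSpace.denseSeq ℝ≥0 k) (TopologicalSpace.denseSeq ℝ≥0 k + (M + 1 : ℕ))
        q.1 q.2 < TopologicalSpace.denseSeq ℝ≥0 k + (M + 1 : ℕ) →
      q.2 (touchTime (TopologicalSpace.denseSeq ℝ≥0 k)
        (TopologicalSpace.denseSeq ℝ≥0 k + (M + 1 : ℕ)) q.1 q.2) ≤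
      q.1 (touchTime (TopologicalSpace.denseSeq ℝ≥0 k)
        (TopologicalSpace.denseSeq ℝ≥0 k + (M + 1 : ℕ)) q.1 q.2) :=
    ae_all_iff.2 fun k => ae_all_iff.2 fun M => ae_le_touchTime hJ (h.noStrictLeap hJ)
      (lt_add_of_pos_right _ (by positivity))
  have key : ∀ (k L : ℕ) (b c d e : ℚ), ∀ᵐ q ∂P.prod P, b < c → c < d → d < e →
      ¬ LowerLeap (TopologicalSpace.denseSeq ℝ≥0 k) L b c d e
        (fun m => {p | p.2 < p.1 + 1 / ((m : ℝ) + 1)}) q := by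
    intro k L b c d e
    by_cases hlt : b < c ∧ c < d ∧ d < e
    swap
    · exact Eventually.of_forall fun q h2 h3 h4 => absurd ⟨h2, h3, h4⟩ hlt
    obtain ⟨hbc, hcd, hde⟩ := hlt
    have hcd' : (c : ℝ) < d := by exact_mod_cast hcd
    have h1 := h.ae_not_lowerLeap (b := b) (c := c) (d := d) (e := e) (by exact_mod_cast hbc)
      hcd' (by exact_mod_cast hde) (TopologicalSpace.denseSeq ℝ≥0 k) L
      (O := fun m => {p | p.2 < p.1 + 1 / ((m : ℝ) + 1)})
      (fun m => measurableSet_lt measurable_snd (measurable_fst.add_const _))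
      (fun m m' hm p (hp : p.2 < p.1 + 1 / ((m' : ℝ) + 1)) =>
        hp.trans_le (by simp only [add_le_add_iff_left]; gcongr)) ?_
    · filter_upwards [h1] with q hq _ _ _
      exact hq
    filter_upwards [htouch] with q hq
    rintro ⟨v, hv, hs, -, hzv, hyv, hO⟩
    obtain ⟨M, hM⟩ := exists_nat_gt v
    have hns : ¬ Separated (TopologicalSpace.denseSeq ℝ≥0 k) v q.1 q.2 := by
      rintro ⟨ε, hε, h2⟩
      obtain ⟨m, hm⟩ := exists_nat_one_div_lt hε
      obtain ⟨u, hu, hu'⟩ := ((hO m).and_eventually (Ioo_mem_nhdsLT hv)).exists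
      have h3 : q.2 u < q.1 u + 1 / ((m : ℝ) + 1) := hu
      linarith [h2 u ⟨hu'.1.le, hu'.2.le⟩]
    have hvM : v < TopologicalSpace.denseSeq ℝ≥0 k + (M + 1 : ℕ) :=
      (hM.trans (by exact_mod_cast Nat.lt_succ_self M)).trans_le le_add_self
    have h2 := hq k M
    rw [touchTime_eq hv.le hvM hs hns] at h2
    linarith [h2 hvM, hyv.2]
  filter_upwards [htouch, ae_all_iff.2 fun k => ae_all_iff.2 fun L => ae_all_iff.2 fun b =>
    ae_all_iff.2 fun c => ae_all_iff.2 fun d => ae_all_iff.2 (key k L b c d)]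
    with q ht hq w v hwv hlt hy hz
  by_contra! hgt
  obtain ⟨b, -, hb2⟩ := exists_rat_btwn (sub_one_lt (q.2 v))
  obtain ⟨c, hc1, hc2⟩ := exists_rat_btwn hgt
  obtain ⟨d, hd1, hd2⟩ := exists_rat_btwn hc2
  obtain ⟨e, he1, -⟩ := exists_rat_btwn (lt_add_one (q.1 v))
  obtain ⟨L, hL⟩ := exists_nat_gt v
  have h1 : ∀ᶠ u in 𝓝[<] v, q.2 u ∈ Set.Ioo (b : ℝ) c := hz.eventually_mem (Ioo_mem_nhds hb2 hc1)
  obtain ⟨w', hw', h2⟩ := (mem_nhdsLT_iff_exists_Ioo_subset' (bot_le.trans_lt hwv)).1 h1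
  obtain ⟨k, hk1, hk2⟩ := exists_denseSeq_between (max_lt hwv hw')
  have hvL : v < TopologicalSpace.denseSeq ℝ≥0 k + (L + 1 : ℕ) :=
    (hL.trans (by exact_mod_cast Nat.lt_succ_self L)).trans_le le_add_self
  -- the paths touch after time `denseSeq ℝ≥0 k` only at time `v`
  have hT : v ≤ touchTime (TopologicalSpace.denseSeq ℝ≥0 k)
      (TopologicalSpace.denseSeq ℝ≥0 k + (L + 1 : ℕ)) q.1 q.2 := by
    by_contra! h3
    have h4 := ht k L (h3.trans hvL)
    exact absurd h4 (not_le.2 (hlt _ ⟨(le_max_left _ _).trans (hk1.le.trans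
      (le_touchTime le_self_add)), h3⟩))
  refine hq k L b c d e (by exact_mod_cast hb2.trans hc1) (by exact_mod_cast hd1)
    (by exact_mod_cast hd2.trans he1) ⟨v, hk2, hL.trans_le le_add_self,
      fun u hu => separated_of_lt_touchTime (hu.trans_le hT), fun u hu => ?_, ⟨hd2, he1⟩,
      fun m => ?_⟩
  · rcases hu.2.lt_or_eq with h4 | rfl
    · exact h2 ⟨(le_max_right _ _).trans_lt (hk1.trans_le hu.1), h4⟩
    · exact ⟨hb2, hc1⟩
  · exact hz.eventually_lt (hy.add_const (1 / ((m : ℝ) + 1)))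
      (lt_add_of_pos_right _ (by positivity))

theorem SetProductInequality.noLeap (h : SetProductInequality P) (hJ : NoFixedJump P) :
    NoLeap P := by
  have h2 := ae_prod_map_reflect_iff.1 (h.map_reflect.ae_le_of_leftLim_eq hJ.map_reflect)
  filter_upwards [h.noStrictLeap hJ, h.ae_le_of_leftLim_eq hJ, h2, ae_not_common_jump hJ]
    with q h1 h3 h4 h5 w v hwv hlt
  have hv : 0 < v := bot_le.trans_lt hwv
  have hne : (𝓝[<] v).NeBot := nhdsLT_neBot_of_exists_lt ⟨0, hv⟩
  obtain ⟨l, hl⟩ := q.1.exists_leftLim v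
  obtain ⟨l', hl'⟩ := q.2.exists_leftLim v
  have hle : l ≤ l' := by
    refine le_of_tendsto_of_tendsto hl hl' ?_
    filter_upwards [Ico_mem_nhdsLT hwv] with u hu
    exact (hlt u hu).le
  rcases hle.lt_or_eq with h6 | rfl
  · exact h1 v hv l l' hl hl' h6
  have h6 := h5 v
  rw [jumpsAt_iff hv hl, jumpsAt_iff hv hl', not_and_or, not_not, not_not] at h6
  rcases h6 with rfl | rfl
  · exact neg_le_neg_iff.1 (h4 w v hwv (fun u hu => neg_lt_neg (hlt u hu)) hl'.neg hl.neg)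
  · exact h3 w v hwv hlt hl hl'

end LeapExclusion

/-! ### The strong Markov property as an identity of integrals -/

/-- A stopping time of the raw filtration, described by the path frozen at deterministic times. -/
structure IsPathStoppingTime (τ : CadlagPath → ℝ≥0) : Prop where
  measurable : Measurable τ
  freeze_le_iff : ∀ u y, τ (CadlagPath.freeze u y) ≤ u ↔ τ y ≤ u

/-- A random variable that is determined by the past of `τ`, described by frozen paths. -/
structure IsPastOf {α : Type*} [MeasurableSpace α] (τ : CadlagPath → ℝ≥0) (ψ : CadlagPath → α) :
    Prop where
  measurable : Measurable ψ
  freeze_eq : ∀ u y, τ y ≤ u → ψ (CadlagPath.freeze u y) = ψ y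

theorem IsPathStoppingTime.isStoppingTime {τ : CadlagPath → ℝ≥0} (hτ : IsPathStoppingTime τ) :
    IsStoppingTime coordFiltration fun y => (τ y : WithTop ℝ≥0) := by
  intro u
  simp only [WithTop.coe_le_coe]
  exact measurableSet_coordFiltration_iff.2
    ⟨measurableSet_le hτ.measurable measurable_const, hτ.freeze_le_iff u⟩

theorem IsPathStoppingTime.isPastOf {τ : CadlagPath → ℝ≥0} (hτ : IsPathStoppingTime τ) :
    IsPastOf τ τ := by
  refine ⟨hτ.measurable, fun u y hu => ?_⟩
  have h1 : τ (y.freeze u) ≤ τ y := by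
    rw [← hτ.freeze_le_iff, CadlagPath.freeze_freeze_of_le hu, hτ.freeze_le_iff]
  refine h1.antisymm ?_
  rw [← hτ.freeze_le_iff, ← CadlagPath.freeze_freeze_of_le (h1.trans hu), hτ.freeze_le_iff]

theorem IsPastOf.measurable_past {α : Type*} [MeasurableSpace α] {τ : CadlagPath → ℝ≥0}
    (hτ : IsPathStoppingTime τ) {ψ : CadlagPath → α} (hψ : IsPastOf τ ψ) :
    Measurable[hτ.isStoppingTime.measurableSpace] ψ := by
  intro S hS
  refine (hτ.isStoppingTime.measurableSet _).2 ⟨?_, fun u => ?_⟩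
  · refine (?_ : CadlagPath.instMeasurableSpace ≤ ⨆ u, coordFiltration u) _ (hψ.measurable hS)
    exact iSup_mono fun u => le_iSup₂_of_le (f := fun j (_ : j ≤ u) =>
      MeasurableSpace.comap (coordProcess j) inferInstance) u le_rfl le_rfl
  · simp only [WithTop.coe_le_coe]
    refine measurableSet_coordFiltration_iff.2 ⟨(hψ.measurable hS).inter
      (measurableSet_le hτ.measurable measurable_const), fun y => ?_⟩
    simp only [Set.mem_inter_iff, Set.mem_preimage, Set.mem_ofPred_eq, hτ.freeze_le_iff]
    refine and_congr_left fun h => ?_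
    rw [hψ.freeze_eq u y h]

theorem lintegral_mul_ofReal_condExp {Ω : Type*} {m m0 : MeasurableSpace Ω} {μ : Measure Ω}
    [IsFiniteMeasure μ] (hm : m ≤ m0) {f f' : Ω → ℝ} (hf : Integrable f μ) (hf0 : 0 ≤ f)
    (hf' : f' =ᵐ[μ] μ[f | m]) {ψ : Ω → ℝ≥0∞} (hψ : Measurable[m] ψ) :
    ∫⁻ ω, ψ ω * ENNReal.ofReal (f ω) ∂μ = ∫⁻ ω, ψ ω * ENNReal.ofReal (f' ω) ∂μ := by
  have hf'i : Integrable f' μ := integrable_condExp.congr hf'.symm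
  have hf'0 : 0 ≤ᵐ[μ] f' := by
    filter_upwards [hf', condExp_nonneg (m := m) (Eventually.of_forall hf0 : 0 ≤ᵐ[μ] f)]
      with ω h1 h2
    rw [h1]
    exact h2
  have hfm : AEMeasurable (fun ω => ENNReal.ofReal (f ω)) μ := hf.aemeasurable.ennreal_ofReal
  have hfm' : AEMeasurable (fun ω => ENNReal.ofReal (f' ω)) μ := hf'i.aemeasurable.ennreal_ofReal
  have key : (μ.withDensity fun ω => ENNReal.ofReal (f ω)).trim hm =
      (μ.withDensity fun ω => ENNReal.ofReal (f' ω)).trim hm := by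
    refine @Measure.ext _ m _ _ fun A hA => ?_
    rw [trim_measurableSet_eq hm hA, trim_measurableSet_eq hm hA,
      withDensity_apply _ (hm _ hA), withDensity_apply _ (hm _ hA),
      ← ofReal_integral_eq_lintegral_ofReal hf.integrableOn (Eventually.of_forall hf0),
      ← ofReal_integral_eq_lintegral_ofReal hf'i.integrableOn (ae_restrict_of_ae hf'0),
      ← setIntegral_condExp hm hf hA]
    congr 1
    exact integral_congr_ae (ae_restrict_of_ae hf'.symm)
  have hψ0 : AEMeasurable ψ μ := (hψ.mono hm le_rfl).aemeasurable
  have h1 : ∀ {k : Ω → ℝ≥0∞}, AEMeasurable k μ →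
      ∫⁻ ω, ψ ω * k ω ∂μ = ∫⁻ ω, ψ ω ∂(μ.withDensity k).trim hm := fun {k} hk => by
    rw [lintegral_trim hm hψ, lintegral_withDensity_eq_lintegral_mul₀ hk hψ0]
    simp only [Pi.mul_apply, mul_comm]
  rw [h1 hfm, h1 hfm', key]

/-- The strong Markov property, with a deterministic time increment, as an identity of
integrals. -/
theorem IsStrongMarkov.exists_lintegral_eq {P : Measure CadlagPath} [IsProbabilityMeasure P]
    (h : IsStrongMarkov coordProcess coordFiltration P) {g : ℝ → ℝ} (hg : Measurable g)
    (hg0 : 0 ≤ g) (hg1 : ∀ x, g x ≤ 1) (t : ℝ≥0) :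
    ∃ f : ℝ≥0 × ℝ → ℝ≥0∞, Measurable f ∧ ∀ τ, IsPathStoppingTime τ → ∀ ψ : CadlagPath → ℝ≥0∞,
      IsPastOf τ ψ → ∫⁻ y, ψ y * ENNReal.ofReal (g (y (τ y + t))) ∂P =
        ∫⁻ y, ψ y * f (τ y, y (τ y)) ∂P := by
  obtain ⟨f, hf, hf'⟩ :=
    h g hg ⟨1, fun x => abs_le.2 ⟨by linarith [show 0 ≤ g x from hg0 x], hg1 x⟩⟩ t
  refine ⟨fun p => ENNReal.ofReal (f p), hf.ennreal_ofReal, fun τ hτ ψ hψ => ?_⟩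
  refine lintegral_mul_ofReal_condExp (f := fun y => g (y (τ y + t)))
    (f' := fun y => f (τ y, y (τ y))) hτ.isStoppingTime.measurableSpace_le ?_ (fun y => hg0 _)
    (hf' τ hτ.isStoppingTime) (hψ.measurable_past hτ)
  refine Integrable.of_bound (C := 1)
    (hg.comp (measurable_id.eval_path (hτ.measurable.add_const t))).aestronglyMeasurable
    (Eventually.of_forall fun y => ?_)
  rw [Real.norm_eq_abs, abs_of_nonneg (hg0 _)]
  exact hg1 _

/-- The number of steps of length `1 / (n + 1)` that lead from `u` to `t` or beyond. -/
noncomputable def stepsTo (t : ℝ≥0) (n : ℕ) (u : ℝ≥0) : ℕ := ⌈((n : ℝ≥0) + 1) * (t - u)⌉₊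

theorem measurable_stepsTo (t : ℝ≥0) (n : ℕ) : Measurable (stepsTo t n) :=
  Nat.measurable_ceil.comp ((measurable_id.const_sub t).const_mul _)

/-- The first time that is not before `t` among those reached from `u` by steps of length
`1 / (n + 1)`. -/
noncomputable def roundTo (t : ℝ≥0) (n : ℕ) (u : ℝ≥0) : ℝ≥0 := u + stepsTo t n u / ((n : ℝ≥0) + 1)

theorem measurable_roundTo (t : ℝ≥0) (n : ℕ) : Measurable (roundTo t n) :=
  measurable_id.add (((measurable_of_countable _).comp (measurable_stepsTo t n)).div_const _)

theorem tendsto_roundTo {t u : ℝ≥0} (hut : u ≤ t) :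
    Tendsto (fun n => roundTo t n u) atTop (𝓝[≥] t) := by
  have h0 : Tendsto (fun n : ℕ => 1 / ((n : ℝ≥0) + 1)) atTop (𝓝 0) :=
    tendsto_one_div_add_atTop_nhds_zero_nat
  have h1 : Tendsto (fun n : ℕ => t + 1 / ((n : ℝ≥0) + 1)) atTop (𝓝 t) := by
    simpa using h0.const_add t
  have hle : ∀ n, t ≤ roundTo t n u := fun n => by
    have hn : 0 < (n : ℝ≥0) + 1 := by positivity
    refine tsub_le_iff_left.1 ((le_div_iff₀ hn).2 ?_)
    rw [mul_comm]
    exact Nat.le_ceil _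
  refine tendsto_nhdsWithin_iff.2 ⟨?_, Eventually.of_forall hle⟩
  refine tendsto_of_tendsto_of_tendsto_of_le_of_le tendsto_const_nhds h1 hle fun n => ?_
  have hn : 0 < (n : ℝ≥0) + 1 := by positivity
  have h2 : (stepsTo t n u : ℝ≥0) / ((n : ℝ≥0) + 1) ≤ (t - u) + 1 / ((n : ℝ≥0) + 1) := by
    rw [div_le_iff₀ hn, add_mul (t - u), one_div, inv_mul_cancel₀ hn.ne', mul_comm (t - u)]
    exact (Nat.ceil_lt_add_one (by positivity)).le
  calc roundTo t n u ≤ u + ((t - u) + 1 / ((n : ℝ≥0) + 1)) := add_le_add_right h2 u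
    _ = t + 1 / ((n : ℝ≥0) + 1) := by rw [← add_assoc, add_tsub_cancel_of_le hut]

/-- The strong Markov property at time `τ` for the value of the process at the random time
`roundTo t n τ`, which takes countably many values given `τ`. -/
theorem IsStrongMarkov.exists_lintegral_roundTo_eq {P : Measure CadlagPath}
    [IsProbabilityMeasure P] (h : IsStrongMarkov coordProcess coordFiltration P) {g : ℝ → ℝ}
    (hg : Measurable g) (hg0 : 0 ≤ g) (hg1 : ∀ x, g x ≤ 1) (t : ℝ≥0) (n : ℕ) :
    ∃ f : ℝ≥0 × ℝ → ℝ≥0∞, Measurable f ∧ ∀ τ, IsPathStoppingTime τ →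
      ∀ ψ : CadlagPath → ℝ≥0∞, IsPastOf τ ψ →
        ∫⁻ y, ψ y * ENNReal.ofReal (g (y (roundTo t n (τ y)))) ∂P =
          ∫⁻ y, ψ y * f (τ y, y (τ y)) ∂P := by
  choose f hf hf' using fun k : ℕ => h.exists_lintegral_eq hg hg0 hg1 (k / ((n : ℝ≥0) + 1))
  have hfm : Measurable fun q : (ℝ≥0 × ℝ) × ℕ => f q.2 q.1 :=
    measurable_from_prod_countable_left hf
  refine ⟨fun p => f (stepsTo t n p.1) p,
    hfm.comp (measurable_id.prodMk ((measurable_stepsTo t n).comp measurable_fst)),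
    fun τ hτ ψ hψ => ?_⟩
  set κ : CadlagPath → ℕ := fun y => stepsTo t n (τ y) with hκ
  have hκm : Measurable κ := (measurable_stepsTo t n).comp hτ.measurable
  set ψk : ℕ → CadlagPath → ℝ≥0∞ := fun k y => if κ y = k then ψ y else 0 with hψk
  have hψkm : ∀ k, IsPastOf τ (ψk k) := fun k =>
    ⟨Measurable.ite (hκm (measurableSet_singleton k)) hψ.measurable measurable_const,
      fun u y hy => by simp only [hψk, hκ, hτ.isPastOf.freeze_eq u y hy, hψ.freeze_eq u y hy]⟩
  have hsum : ∀ (F : CadlagPath → ℕ → ℝ≥0∞) (y : CadlagPath),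
      ψ y * F y (κ y) = ∑' k, ψk k y * F y k := fun F y => by
    rw [tsum_eq_single (κ y) fun k hk => by simp [hψk, hk.symm]]
    simp [hψk]
  have h1 : ∀ k, Measurable fun y => ψk k y *
      ENNReal.ofReal (g (y (τ y + k / ((n : ℝ≥0) + 1)))) := fun k =>
    (hψkm k).measurable.mul
      (hg.comp (measurable_id.eval_path (hτ.measurable.add_const _))).ennreal_ofReal
  have h2 : ∀ k, Measurable fun y => ψk k y * f k (τ y, y (τ y)) := fun k =>
    (hψkm k).measurable.mul
      ((hf k).comp (hτ.measurable.prodMk (measurable_id.eval_path hτ.measurable)))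
  calc ∫⁻ y, ψ y * ENNReal.ofReal (g (y (roundTo t n (τ y)))) ∂P
      = ∫⁻ y, ∑' k, ψk k y * ENNReal.ofReal (g (y (τ y + k / ((n : ℝ≥0) + 1)))) ∂P :=
        lintegral_congr fun y => hsum
          (fun y k => ENNReal.ofReal (g (y (τ y + k / ((n : ℝ≥0) + 1))))) y
    _ = ∑' k, ∫⁻ y, ψk k y * ENNReal.ofReal (g (y (τ y + k / ((n : ℝ≥0) + 1)))) ∂P :=
        lintegral_tsum fun k => (h1 k).aemeasurable
    _ = ∑' k, ∫⁻ y, ψk k y * f k (τ y, y (τ y)) ∂P :=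
        tsum_congr fun k => hf' k τ hτ (ψk k) (hψkm k)
    _ = ∫⁻ y, ∑' k, ψk k y * f k (τ y, y (τ y)) ∂P :=
        (lintegral_tsum fun k => (h2 k).aemeasurable).symm
    _ = ∫⁻ y, ψ y * f (stepsTo t n (τ y)) (τ y, y (τ y)) ∂P :=
        lintegral_congr fun y => (hsum (fun y k => f k (τ y, y (τ y))) y).symm

/-! ### Exchanging two copies at their touching time -/

theorem isPathStoppingTime_touchTime_left {s t : ℝ≥0} (h : s ≤ t) (z : CadlagPath) :
    IsPathStoppingTime fun y => touchTime s t y z :=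
  ⟨(measurable_touchTime h).comp (measurable_id.prodMk measurable_const), fun _ _ =>
    touchTime_le_congr h (fun _ hp => CadlagPath.freeze_apply_of_le _ hp) fun _ _ => rfl⟩

theorem isPathStoppingTime_touchTime_right {s t : ℝ≥0} (h : s ≤ t) (y : CadlagPath) :
    IsPathStoppingTime fun z => touchTime s t y z :=
  ⟨(measurable_touchTime h).comp (measurable_const.prodMk measurable_id), fun _ _ =>
    touchTime_le_congr h (fun _ _ => rfl) fun _ hp => CadlagPath.freeze_apply_of_le _ hp⟩

open Classical in
/-- The weight `U(y) V(z)` on the event that `y` and `z` meet at their touching time. -/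
noncomputable def meetWeight (s t : ℝ≥0) (U V : CadlagPath → ℝ≥0∞)
    (q : CadlagPath × CadlagPath) : ℝ≥0∞ :=
  if q.1 (touchTime s t q.1 q.2) = q.2 (touchTime s t q.1 q.2) then U q.1 * V q.2 else 0

section Exchange

variable {s t : ℝ≥0} {U V : CadlagPath → ℝ≥0∞}

theorem measurable_meetWeight (hst : s ≤ t) (hU : Measurable U) (hV : Measurable V) :
    Measurable (meetWeight s t U V) := by
  refine Measurable.ite ?_ ((hU.comp measurable_fst).mul (hV.comp measurable_snd)) measurable_const
  exact measurableSet_eq_fun (measurable_fst.eval_path (measurable_touchTime hst))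
    (measurable_snd.eval_path (measurable_touchTime hst))

theorem meetWeight_le (q : CadlagPath × CadlagPath) :
    meetWeight s t U V q ≤ U q.1 * V q.2 := by
  unfold meetWeight
  split_ifs
  exacts [le_rfl, zero_le]

theorem meetWeight_freeze_left (hst : s ≤ t) (hU : ∀ u ≥ s, ∀ y, U (CadlagPath.freeze u y) = U y)
    {u : ℝ≥0} {y z : CadlagPath} (h : touchTime s t y z ≤ u) :
    meetWeight s t U V (y.freeze u, z) = meetWeight s t U V (y, z) := by
  have h1 : touchTime s t (y.freeze u) z = touchTime s t y z :=
    (isPathStoppingTime_touchTime_left hst z).isPastOf.freeze_eq u y h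
  simp only [meetWeight, h1, CadlagPath.freeze_apply_of_le y h, hU u ((le_touchTime hst).trans h) y]

theorem meetWeight_freeze_right (hst : s ≤ t) (hV : ∀ u ≥ s, ∀ z, V (CadlagPath.freeze u z) = V z)
    {u : ℝ≥0} {y z : CadlagPath} (h : touchTime s t y z ≤ u) :
    meetWeight s t U V (y, z.freeze u) = meetWeight s t U V (y, z) := by
  have h1 : touchTime s t y (z.freeze u) = touchTime s t y z :=
    (isPathStoppingTime_touchTime_right hst y).isPastOf.freeze_eq u z h
  simp only [meetWeight, h1, CadlagPath.freeze_apply_of_le z h, hV u ((le_touchTime hst).trans h) z]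

variable {P : Measure CadlagPath} [IsProbabilityMeasure P]

/-- On the event that the copies meet at their touching time `T`, their values at the time
`roundTo t n T` can be exchanged: given the past of `T` these values are independent, with laws that
depend only on `T` and on the common value of the two copies at `T`. -/
theorem IsStrongMarkov.lintegral_meetWeight_roundTo
    (hP : IsStrongMarkov coordProcess coordFiltration P) (hst : s ≤ t) (hUm : Measurable U)
    (hVm : Measurable V) (hU : ∀ u ≥ s, ∀ y, U (CadlagPath.freeze u y) = U y)
    (hV : ∀ u ≥ s, ∀ z, V (CadlagPath.freeze u z) = V z) {g h : ℝ → ℝ} (hg : Measurable g)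
    (hg0 : 0 ≤ g) (hg1 : ∀ x, g x ≤ 1) (hh : Measurable h) (hh0 : 0 ≤ h) (hh1 : ∀ x, h x ≤ 1)
    (n : ℕ) :
    ∫⁻ q, meetWeight s t U V q * (ENNReal.ofReal (g (q.1 (roundTo t n (touchTime s t q.1 q.2)))) *
        ENNReal.ofReal (h (q.2 (roundTo t n (touchTime s t q.1 q.2))))) ∂P.prod P =
      ∫⁻ q, meetWeight s t U V q * (ENNReal.ofReal (h (q.1 (roundTo t n (touchTime s t q.1 q.2)))) *
        ENNReal.ofReal (g (q.2 (roundTo t n (touchTime s t q.1 q.2))))) ∂P.prod P := by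
  have hWm := measurable_meetWeight hst hUm hVm
  have hT := measurable_touchTime hst
  have hρ : Measurable fun q : CadlagPath × CadlagPath => roundTo t n (touchTime s t q.1 q.2) :=
    (measurable_roundTo t n).comp hT
  have h1ρ : ∀ {g : ℝ → ℝ}, Measurable g → Measurable fun q : CadlagPath × CadlagPath =>
      ENNReal.ofReal (g (q.1 (roundTo t n (touchTime s t q.1 q.2)))) := fun hg =>
    (hg.comp (measurable_fst.eval_path hρ)).ennreal_ofReal
  have h2ρ : ∀ {g : ℝ → ℝ}, Measurable g → Measurable fun q : CadlagPath × CadlagPath =>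
      ENNReal.ofReal (g (q.2 (roundTo t n (touchTime s t q.1 q.2)))) := fun hg =>
    (hg.comp (measurable_snd.eval_path hρ)).ennreal_ofReal
  have h2T : ∀ {F : ℝ≥0 × ℝ → ℝ≥0∞}, Measurable F → Measurable fun q : CadlagPath × CadlagPath =>
      F (touchTime s t q.1 q.2, q.2 (touchTime s t q.1 q.2)) := fun hF =>
    hF.comp (hT.prodMk (measurable_snd.eval_path hT))
  obtain ⟨G, hGm, hG⟩ := hP.exists_lintegral_roundTo_eq hg hg0 hg1 t n
  obtain ⟨H, hHm, hH⟩ := hP.exists_lintegral_roundTo_eq hh hh0 hh1 t n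
  have key : ∀ {g h : ℝ → ℝ} {G H : ℝ≥0 × ℝ → ℝ≥0∞}, Measurable g → Measurable h → Measurable G →
      Measurable H → (∀ τ, IsPathStoppingTime τ → ∀ ψ : CadlagPath → ℝ≥0∞, IsPastOf τ ψ →
        ∫⁻ y, ψ y * ENNReal.ofReal (g (y (roundTo t n (τ y)))) ∂P =
          ∫⁻ y, ψ y * G (τ y, y (τ y)) ∂P) →
      (∀ τ, IsPathStoppingTime τ → ∀ ψ : CadlagPath → ℝ≥0∞, IsPastOf τ ψ →
        ∫⁻ y, ψ y * ENNReal.ofReal (h (y (roundTo t n (τ y)))) ∂P =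
          ∫⁻ y, ψ y * H (τ y, y (τ y)) ∂P) →
      ∫⁻ q, meetWeight s t U V q * (ENNReal.ofReal (g (q.1 (roundTo t n (touchTime s t q.1 q.2)))) *
          ENNReal.ofReal (h (q.2 (roundTo t n (touchTime s t q.1 q.2))))) ∂P.prod P =
        ∫⁻ q, meetWeight s t U V q * (G (touchTime s t q.1 q.2, q.2 (touchTime s t q.1 q.2)) *
          H (touchTime s t q.1 q.2, q.2 (touchTime s t q.1 q.2))) ∂P.prod P := by
    intro g h G H hg hh hGm hHm hG hH
    calc ∫⁻ q, meetWeight s t U V q *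
          (ENNReal.ofReal (g (q.1 (roundTo t n (touchTime s t q.1 q.2)))) *
          ENNReal.ofReal (h (q.2 (roundTo t n (touchTime s t q.1 q.2))))) ∂P.prod P
        = ∫⁻ z, ∫⁻ y, meetWeight s t U V (y, z) *
            ENNReal.ofReal (h (z (roundTo t n (touchTime s t y z)))) *
            ENNReal.ofReal (g (y (roundTo t n (touchTime s t y z)))) ∂P ∂P := by
          refine (lintegral_prod_symm' _ (hWm.mul ((h1ρ hg).mul (h2ρ hh)))).trans
            (lintegral_congr fun z => lintegral_congr fun y => ?_)
          simp only [Pi.mul_apply]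
          ring
      _ = ∫⁻ z, ∫⁻ y, meetWeight s t U V (y, z) *
            ENNReal.ofReal (h (z (roundTo t n (touchTime s t y z)))) *
            G (touchTime s t y z, y (touchTime s t y z)) ∂P ∂P := by
          -- the strong Markov property of the first copy, with the second one fixed
          refine lintegral_congr fun z => ?_
          refine hG _ (isPathStoppingTime_touchTime_left hst z)
            (fun y => meetWeight s t U V (y, z) *
            ENNReal.ofReal (h (z (roundTo t n (touchTime s t y z)))))
            ⟨(hWm.mul (h2ρ hh)).comp measurable_prodMk_right, fun u y hu => ?_⟩
          have h1 : touchTime s t (y.freeze u) z = touchTime s t y z :=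
            (isPathStoppingTime_touchTime_left hst z).isPastOf.freeze_eq u y hu
          rw [meetWeight_freeze_left hst hU hu, h1]
      _ = ∫⁻ z, ∫⁻ y, meetWeight s t U V (y, z) *
            G (touchTime s t y z, z (touchTime s t y z)) *
            ENNReal.ofReal (h (z (roundTo t n (touchTime s t y z)))) ∂P ∂P := by
          refine lintegral_congr fun z => lintegral_congr fun y => ?_
          by_cases hyz : y (touchTime s t y z) = z (touchTime s t y z)
          · rw [hyz]
            ring
          · simp [meetWeight, hyz]
      _ = ∫⁻ y, ∫⁻ z, meetWeight s t U V (y, z) *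
            G (touchTime s t y z, z (touchTime s t y z)) *
            ENNReal.ofReal (h (z (roundTo t n (touchTime s t y z)))) ∂P ∂P :=
          (lintegral_lintegral_swap ((hWm.mul (h2T hGm)).mul (h2ρ hh)).aemeasurable).symm
      _ = ∫⁻ y, ∫⁻ z, meetWeight s t U V (y, z) *
            G (touchTime s t y z, z (touchTime s t y z)) *
            H (touchTime s t y z, z (touchTime s t y z)) ∂P ∂P := by
          -- the strong Markov property of the second copy, with the first one fixed
          refine lintegral_congr fun y => ?_
          refine hH _ (isPathStoppingTime_touchTime_right hst y)
            (fun z => meetWeight s t U V (y, z) *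
              G (touchTime s t y z, z (touchTime s t y z)))
            ⟨(hWm.mul (h2T hGm)).comp measurable_prodMk_left, fun u z hu => ?_⟩
          have h1 : touchTime s t y (z.freeze u) = touchTime s t y z :=
            (isPathStoppingTime_touchTime_right hst y).isPastOf.freeze_eq u z hu
          rw [meetWeight_freeze_right hst hV hu, h1, CadlagPath.freeze_apply_of_le z hu]
      _ = ∫⁻ q, meetWeight s t U V q * (G (touchTime s t q.1 q.2, q.2 (touchTime s t q.1 q.2)) *
          H (touchTime s t q.1 q.2, q.2 (touchTime s t q.1 q.2))) ∂P.prod P := by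
          refine Eq.symm ((lintegral_prod _ (hWm.mul ((h2T hGm).mul (h2T hHm))).aemeasurable).trans
            (lintegral_congr fun y => lintegral_congr fun z => ?_))
          simp only [Pi.mul_apply]
          ring
  rw [key hg hh hGm hHm hG hH, key hh hg hHm hGm hH hG]
  refine lintegral_congr fun q => ?_
  ring

/-- The exchange at the fixed time `t`, to which the times `roundTo t n T` decrease. -/
theorem IsStrongMarkov.lintegral_meetWeight
    (hP : IsStrongMarkov coordProcess coordFiltration P) (hst : s ≤ t) (hUm : Measurable U)
    (hVm : Measurable V) (hU : ∀ u ≥ s, ∀ y, U (CadlagPath.freeze u y) = U y)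
    (hV : ∀ u ≥ s, ∀ z, V (CadlagPath.freeze u z) = V z) {C : ℝ≥0} (hUC : ∀ y, U y ≤ C)
    (hVC : ∀ z, V z ≤ C) {g h : ℝ → ℝ} (hg : Continuous g)
    (hg0 : 0 ≤ g) (hg1 : ∀ x, g x ≤ 1) (hh : Continuous h) (hh0 : 0 ≤ h) (hh1 : ∀ x, h x ≤ 1) :
    ∫⁻ q, meetWeight s t U V q * (ENNReal.ofReal (g (q.1 t)) * ENNReal.ofReal (h (q.2 t)))
        ∂P.prod P =
      ∫⁻ q, meetWeight s t U V q * (ENNReal.ofReal (h (q.1 t)) * ENNReal.ofReal (g (q.2 t)))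
        ∂P.prod P := by
  have hWm := measurable_meetWeight hst hUm hVm
  have hρ : ∀ n, Measurable fun q : CadlagPath × CadlagPath =>
      roundTo t n (touchTime s t q.1 q.2) := fun n =>
    (measurable_roundTo t n).comp (measurable_touchTime hst)
  have key : ∀ {g h : ℝ → ℝ}, Continuous g → (∀ x, g x ≤ 1) → Continuous h → (∀ x, h x ≤ 1) →
      Tendsto (fun n => ∫⁻ q, meetWeight s t U V q *
        (ENNReal.ofReal (g (q.1 (roundTo t n (touchTime s t q.1 q.2)))) *
          ENNReal.ofReal (h (q.2 (roundTo t n (touchTime s t q.1 q.2))))) ∂P.prod P) atTop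
        (𝓝 (∫⁻ q, meetWeight s t U V q *
          (ENNReal.ofReal (g (q.1 t)) * ENNReal.ofReal (h (q.2 t))) ∂P.prod P)) := by
    intro g h hg hg1 hh hh1
    refine tendsto_lintegral_of_dominated_convergence (fun _ => (C : ℝ≥0∞) * C)
      (fun n => hWm.mul (((hg.measurable.comp (measurable_fst.eval_path (hρ n))).ennreal_ofReal).mul
        ((hh.measurable.comp (measurable_snd.eval_path (hρ n))).ennreal_ofReal)))
      (fun n => Eventually.of_forall fun q => ?_) ?_ (Eventually.of_forall fun q => ?_)
    · refine (mul_le_mul' (meetWeight_le q) (mul_le_mul' (ENNReal.ofReal_le_one.2 (hg1 _))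
        (ENNReal.ofReal_le_one.2 (hh1 _)))).trans ?_
      rw [mul_one, mul_one]
      exact mul_le_mul' (hUC _) (hVC _)
    · simp [ENNReal.mul_eq_top]
    · have hr := tendsto_roundTo (touchTime_le hst : touchTime s t q.1 q.2 ≤ t)
      have h1 := ENNReal.tendsto_ofReal
        ((hg.tendsto _).comp ((q.1.continuousWithinAt_Ici t).tendsto.comp hr))
      have h2 := ENNReal.tendsto_ofReal
        ((hh.tendsto _).comp ((q.2.continuousWithinAt_Ici t).tendsto.comp hr))
      have hW : meetWeight s t U V q ≠ ∞ := ((meetWeight_le q).trans_lt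
        (ENNReal.mul_lt_top ((hUC _).trans_lt ENNReal.coe_lt_top)
          ((hVC _).trans_lt ENNReal.coe_lt_top))).ne
      exact ENNReal.Tendsto.const_mul (ENNReal.Tendsto.mul h1 (Or.inr ENNReal.ofReal_ne_top) h2
        (Or.inr ENNReal.ofReal_ne_top)) (Or.inr hW)
  refine tendsto_nhds_unique (key hg hg1 hh hh1) ((key hh hh1 hg hg1).congr fun n => ?_)
  exact (hP.lintegral_meetWeight_roundTo hst hUm hVm hU hV hg.measurable hg0 hg1 hh.measurable hh0
    hh1 n).symm

end Exchange

/-! ### The product inequality for almost-continuous diffusions -/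

/-- Continuous functions that increase to the indicator function of `(a, b)`. -/
noncomputable def bump (a b : ℝ) (k : ℕ) (x : ℝ) : ℝ := min 1 (k * max 0 (min (x - a) (b - x)))

theorem continuous_bump (a b : ℝ) (k : ℕ) : Continuous (bump a b k) := by
  unfold bump
  fun_prop

theorem bump_nonneg (a b : ℝ) (k : ℕ) : 0 ≤ bump a b k := fun x => by
  simp only [Pi.zero_apply, bump]
  positivity

theorem bump_le_one (a b : ℝ) (k : ℕ) (x : ℝ) : bump a b k x ≤ 1 := min_le_left _ _

theorem bump_mono (a b : ℝ) (x : ℝ) : Monotone fun k => bump a b k x := fun j k h => by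
  have h1 : (j : ℝ) ≤ k := by exact_mod_cast h
  exact min_le_min_left _ (mul_le_mul_of_nonneg_right h1 (le_max_left _ _))

theorem mem_Ioo_of_bump_ne_zero {a b : ℝ} {k : ℕ} {x : ℝ} (h : bump a b k x ≠ 0) :
    x ∈ Set.Ioo a b := by
  by_contra hx
  refine h ?_
  have h1 : min (x - a) (b - x) ≤ 0 := by
    by_contra! h2
    rw [lt_min_iff] at h2
    exact hx ⟨by linarith, by linarith⟩
  rw [bump, max_eq_left h1, mul_zero]
  exact min_eq_right zero_le_one

theorem exists_bump_eq_one {a b x : ℝ} (hx : x ∈ Set.Ioo a b) :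
    ∃ K, ∀ k ≥ K, bump a b k x = 1 := by
  have h0 : 0 < min (x - a) (b - x) := lt_min (by linarith [hx.1]) (by linarith [hx.2])
  obtain ⟨K, hK⟩ := exists_nat_gt (1 / min (x - a) (b - x))
  refine ⟨K, fun k hk => min_eq_left ?_⟩
  rw [max_eq_right h0.le]
  have h1 : (K : ℝ) ≤ k := by exact_mod_cast hk
  exact ((div_lt_iff₀ h0).1 (hK.trans_le h1)).le

open Classical in
/-- An integral over the paths that are in `S` at time `s` and in `(a, b)` at time `t` is the
increasing limit of integrals of truncated weights against continuous functions. -/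
theorem setLIntegral_eq_iSup_bump {P : Measure CadlagPath} {s t : ℝ≥0} {U : CadlagPath → ℝ≥0}
    (hU : Measurable U) {S : Set ℝ} (hS : MeasurableSet S) (a b : ℝ) :
    ∫⁻ y in {y | y s ∈ S ∧ y t ∈ Set.Ioo a b}, (U y : ℝ≥0∞) ∂P =
        ⨆ k : ℕ, ∫⁻ y, (if y s ∈ S then ((min (U y) k : ℝ≥0) : ℝ≥0∞) else 0) *
          ENNReal.ofReal (bump a b k (y t)) ∂P ∧
      Monotone fun k : ℕ => ∫⁻ y, (if y s ∈ S then ((min (U y) k : ℝ≥0) : ℝ≥0∞) else 0) *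
          ENNReal.ofReal (bump a b k (y t)) ∂P := by
  have hm : MeasurableSet {y : CadlagPath | y s ∈ S ∧ y t ∈ Set.Ioo a b} :=
    (CadlagPath.measurable_apply s hS).inter (CadlagPath.measurable_apply t measurableSet_Ioo)
  have hmono : Monotone fun (k : ℕ) (y : CadlagPath) =>
      (if y s ∈ S then ((min (U y) k : ℝ≥0) : ℝ≥0∞) else 0) *
        ENNReal.ofReal (bump a b k (y t)) := fun j k hjk y => by
    refine mul_le_mul' ?_ (ENNReal.ofReal_le_ofReal (bump_mono a b _ hjk))
    split_ifs
    · refine ENNReal.coe_le_coe.2 (min_le_min_left _ ?_)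
      exact_mod_cast hjk
    · exact le_rfl
  refine ⟨?_, fun j k hjk => lintegral_mono (hmono hjk)⟩
  rw [← lintegral_iSup (fun k => ?_) hmono, ← lintegral_indicator hm]
  · refine lintegral_congr fun y => ?_
    by_cases hy : y s ∈ S ∧ y t ∈ Set.Ioo a b
    · rw [Set.indicator_of_mem (show y ∈ {y : CadlagPath | y s ∈ S ∧ y t ∈ Set.Ioo a b} from hy)]
      refine le_antisymm ?_ (iSup_le fun k => ?_)
      · obtain ⟨K, hK⟩ := exists_bump_eq_one hy.2
        obtain ⟨K', hK'⟩ := exists_nat_ge (U y)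
        refine le_iSup_of_le (max K K') ?_
        have h1 : U y ≤ ((max K K' : ℕ) : ℝ≥0) :=
          hK'.trans (by exact_mod_cast le_max_right K K')
        rw [if_pos hy.1, min_eq_left h1, hK _ (le_max_left _ _), ENNReal.ofReal_one, mul_one]
      · rw [if_pos hy.1]
        calc _ ≤ (U y : ℝ≥0∞) * 1 := mul_le_mul' (ENNReal.coe_le_coe.2 (min_le_left _ _))
              (ENNReal.ofReal_le_one.2 (bump_le_one _ _ _ _))
          _ = U y := mul_one _
    · rw [Set.indicator_of_notMem (show y ∉ {y : CadlagPath | y s ∈ S ∧ y t ∈ Set.Ioo a b} from hy),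
        eq_comm, ENNReal.iSup_eq_zero]
      intro k
      by_cases h1 : y s ∈ S
      · have h2 : bump a b k (y t) = 0 := by
          by_contra h3
          exact hy ⟨h1, mem_Ioo_of_bump_ne_zero h3⟩
        simp [h2]
      · simp [h1]
  · exact (Measurable.ite (CadlagPath.measurable_apply s hS)
      (hU.min measurable_const).coe_nnreal_ennreal measurable_const).mul
      ((continuous_bump a b k).measurable.comp (CadlagPath.measurable_apply t)).ennreal_ofReal

section Diffusion

variable {P : Measure CadlagPath} [IsProbabilityMeasure P] {s t : ℝ≥0}

/-- Two copies that change order between `s` and `t` meet at their touching time. -/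
theorem NoLeap.ae_eq_touchTime (hL : NoLeap P) (hJ : NoFixedJump P) (hst : s < t) :
    ∀ᵐ q ∂P.prod P, q.1 s < q.2 s → q.2 t < q.1 t →
      q.1 (touchTime s t q.1 q.2) = q.2 (touchTime s t q.1 q.2) := by
  filter_upwards [hL, ae_le_touchTime hJ hL.noStrictLeap hst] with q h1 h2 hs ht
  have h3 : q.1 (touchTime s t q.1 q.2) ≤ q.2 (touchTime s t q.1 q.2) :=
    h1 s _ (lt_touchTime hst hs) fun u hu => (separated_of_lt_touchTime hu.2).lt ⟨hu.1, le_rfl⟩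
  rcases (touchTime_le hst.le : touchTime s t q.1 q.2 ≤ t).lt_or_eq with h4 | h4
  · exact h3.antisymm (h2 h4)
  · rw [h4] at h3
    exact absurd ht (not_lt.2 h3)

/-- The product inequality with continuous functions in place of indicators of intervals, and with
bounded weights. -/
theorem IsAlmostContinuousDiffusion.lintegral_mul_le
    (hP : IsAlmostContinuousDiffusion coordProcess coordFiltration P) (hst : s < t)
    {U V : CadlagPath → ℝ≥0∞} (hUm : Measurable U)
    (hVm : Measurable V) (hU : ∀ u ≥ s, ∀ y, U (CadlagPath.freeze u y) = U y)
    (hV : ∀ u ≥ s, ∀ z, V (CadlagPath.freeze u z) = V z) {C : ℝ≥0} (hUC : ∀ y, U y ≤ C)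
    (hVC : ∀ z, V z ≤ C) {a c : ℝ} (hUa : ∀ y, U y ≠ 0 → y s < a) (hVa : ∀ z, V z ≠ 0 → a < z s)
    {g h : ℝ → ℝ} (hg : Continuous g) (hg0 : 0 ≤ g) (hg1 : ∀ x, g x ≤ 1) (hh : Continuous h)
    (hh0 : 0 ≤ h) (hh1 : ∀ x, h x ≤ 1) (hgc : ∀ x, g x ≠ 0 → c < x) (hhc : ∀ x, h x ≠ 0 → x < c) :
    (∫⁻ y, U y * ENNReal.ofReal (g (y t)) ∂P) * (∫⁻ z, V z * ENNReal.ofReal (h (z t)) ∂P) ≤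
      (∫⁻ y, U y * ENNReal.ofReal (h (y t)) ∂P) * (∫⁻ z, V z * ENNReal.ofReal (g (z t)) ∂P) := by
  have hL := hP.2.noLeap
  have hJ : NoFixedJump P := measure_jumpsAt_eq_zero hP.2.continuousInProbability
  have hm : ∀ {W : CadlagPath → ℝ≥0∞} {f : ℝ → ℝ}, Measurable W → Continuous f →
      AEMeasurable (fun y => W y * ENNReal.ofReal (f (y t))) P := fun hW hf =>
    (hW.mul (hf.measurable.comp (CadlagPath.measurable_apply t)).ennreal_ofReal).aemeasurable
  rw [← lintegral_prod_mul (hm hUm hg) (hm hVm hh), ← lintegral_prod_mul (hm hUm hh) (hm hVm hg)]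
  calc ∫⁻ q, U q.1 * ENNReal.ofReal (g (q.1 t)) * (V q.2 * ENNReal.ofReal (h (q.2 t))) ∂P.prod P
      = ∫⁻ q, meetWeight s t U V q * (ENNReal.ofReal (g (q.1 t)) * ENNReal.ofReal (h (q.2 t)))
          ∂P.prod P := by
        refine lintegral_congr_ae ?_
        filter_upwards [hL.ae_eq_touchTime hJ hst] with q hq
        rw [mul_mul_mul_comm]
        by_cases h0 : U q.1 = 0 ∨ V q.2 = 0 ∨ g (q.1 t) = 0 ∨ h (q.2 t) = 0
        · rcases h0 with h0 | h0 | h0 | h0 <;> simp [meetWeight, h0]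
        · push Not at h0
          have h1 := hq ((hUa _ h0.1).trans (hVa _ h0.2.1))
            ((hhc _ h0.2.2.2).trans (hgc _ h0.2.2.1))
          rw [meetWeight, if_pos h1]
    _ = ∫⁻ q, meetWeight s t U V q * (ENNReal.ofReal (h (q.1 t)) * ENNReal.ofReal (g (q.2 t)))
          ∂P.prod P :=
        hP.1.lintegral_meetWeight hst.le hUm hVm hU hV hUC hVC hg hg0 hg1 hh hh0 hh1
    _ ≤ ∫⁻ q, U q.1 * ENNReal.ofReal (h (q.1 t)) * (V q.2 * ENNReal.ofReal (g (q.2 t)))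
          ∂P.prod P := by
        refine lintegral_mono fun q => ?_
        rw [mul_mul_mul_comm]
        exact mul_le_mul_left (meetWeight_le q) _

theorem IsAlmostContinuousDiffusion.productInequality
    (hP : IsAlmostContinuousDiffusion coordProcess coordFiltration P) :
    ProductInequality coordProcess coordFiltration P := by
  classical
  intro s t hst U V hU hV a b c d e hbc hcd hde
  have hUm : Measurable U := hU.mono (coordFiltration.le s) le_rfl
  have hVm : Measurable V := hV.mono (coordFiltration.le s) le_rfl
  obtain ⟨hL₁, mL₁⟩ := setLIntegral_eq_iSup_bump (P := P) (s := s) (t := t) hUm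
    (measurableSet_Iio (a := a)) d e
  obtain ⟨hL₂, mL₂⟩ := setLIntegral_eq_iSup_bump (P := P) (s := s) (t := t) hVm
    (measurableSet_Ioi (a := a)) b c
  obtain ⟨hR₁, mR₁⟩ := setLIntegral_eq_iSup_bump (P := P) (s := s) (t := t) hUm
    (measurableSet_Iio (a := a)) b c
  obtain ⟨hR₂, mR₂⟩ := setLIntegral_eq_iSup_bump (P := P) (s := s) (t := t) hVm
    (measurableSet_Ioi (a := a)) d e
  refine (mul_le_mul' hL₁.le hL₂.le).trans ((?_ : _ ≤ _).trans (mul_le_mul' hR₁.ge hR₂.ge))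
  rw [ENNReal.iSup_mul]
  refine iSup_le fun i => ?_
  rw [ENNReal.mul_iSup]
  refine iSup_le fun j => ?_
  set k := max i j
  refine (mul_le_mul' (mL₁ (le_max_left i j)) (mL₂ (le_max_right i j))).trans (le_trans ?_
    (mul_le_mul' (le_iSup _ k) (le_iSup _ k)))
  have hite : ∀ {W : CadlagPath → ℝ≥0}, Measurable[coordFiltration s] W → ∀ S : Set ℝ,
      ∀ u ≥ s, ∀ y : CadlagPath,
        (if y.freeze u s ∈ S then ((min (W (y.freeze u)) k : ℝ≥0) : ℝ≥0∞) else 0) =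
          if y s ∈ S then ((min (W y) k : ℝ≥0) : ℝ≥0∞) else 0 := fun hW S u hu y => by
    rw [CadlagPath.freeze_apply_of_le y hu, apply_freeze_eq_of_measurable hu hW]
  have hmeas : ∀ {W : CadlagPath → ℝ≥0}, Measurable W → ∀ S : Set ℝ, MeasurableSet S →
      Measurable fun y : CadlagPath =>
        if y s ∈ S then ((min (W y) k : ℝ≥0) : ℝ≥0∞) else 0 := fun hW S hS =>
    Measurable.ite (CadlagPath.measurable_apply s hS)
      (hW.min measurable_const).coe_nnreal_ennreal measurable_const
  have hbound : ∀ (W : CadlagPath → ℝ≥0) (S : Set ℝ) (y : CadlagPath),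
      (if y s ∈ S then ((min (W y) k : ℝ≥0) : ℝ≥0∞) else 0) ≤ ((k : ℝ≥0) : ℝ≥0∞) := fun W S y => by
    split_ifs
    exacts [ENNReal.coe_le_coe.2 (min_le_right _ _), zero_le]
  exact hP.lintegral_mul_le (c := c) hst (hmeas hUm _ measurableSet_Iio)
    (hmeas hVm _ measurableSet_Ioi) (hite hU _) (hite hV _) (hbound U _) (hbound V _)
    (fun y hy => by
      by_contra h1
      exact hy (if_neg h1))
    (fun y hy => by
      by_contra h1
      exact hy (if_neg h1))
    (continuous_bump d e k) (bump_nonneg d e k) (bump_le_one d e k) (continuous_bump b c k)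
    (bump_nonneg b c k) (bump_le_one b c k)
    (fun x hx => hcd.trans_lt (mem_Ioo_of_bump_ne_zero hx).1)
    (fun x hx => (mem_Ioo_of_bump_ne_zero hx).2)

end Diffusion

theorem mainTheorem6 (P : Measure CadlagPath) [IsProbabilityMeasure P]
    (hP : ContinuousInProbability coordProcess P) :
    (IsAlmostContinuousDiffusion coordProcess coordFiltration P →
        ProductInequality coordProcess coordFiltration P) ∧
      (ProductInequality coordProcess coordFiltration P →
        IsAlmostContinuous coordProcess P) :=
  ⟨fun h => h.productInequality, fun h =>
    (h.setProductInequality.noLeap (measure_jumpsAt_eq_zero hP)).isAlmostContinuous hP⟩
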